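/- Let $E$ be a smooth manifold of dimension $n+m$ with a torsion-free linear connection $\Gamma$ on $TE$, let $M$ be a smooth manifold of dimension $n$ with a torsion-free linear connection $\Theta$ on $TM$, and let $\mathrm{pr}_M\colon M\times E\to M$ be the projection. Let $J^r(E,n)$ be the space of $r$-jets $[L]^r_p$ of $n$-dimensional embedded submanifolds $L\ni p$ of $E$, let $J^r\mathrm{pr}_M$ be the bundle of $r$-jets $[s]^r_x$ of local sections of $\mathrm{pr}_M$ (that is, of smooth maps $s\colon U\subseteq M\to E$), and let $\mathrm{Imm}\,J^r\mathrm{pr}_M\subseteq J^r\mathrm{pr}_M$ be the subset of jets of immersions. The $r$-prolongation $\mathrm{pr}_E^{(r)}\colon \mathrm{Imm}\,J^r\mathrm{pr}_M\to J^r(E,n)$ sends $[s]^r_x$ to $[s(U)]^r_{s(x)}$, where $U$ is a small neighbourhood of $x$. Let $\dot\Gamma$ be the connection on $J^1(E,n)\to E$ whose vertical projection assigns to a tangent vector $\xi$ of $J^1(E,n)$ at $[L]^1_p$ the homomorphism $T_pL\to T_pE/T_pL$, $w\mapsto [\nabla_{\xi}W]$, where $W$ extends $w$ to a section of the tautological bundle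 of $n$-planes and $\nabla$ is induced by $\Gamma$. In coordinates $(u^\lambda,u^i,u^i_\lambda)$, $$\dot\Gamma_A{}^k{}_\xi=\Gamma_A{}^k{}_\xi+\Gamma_A{}^k{}_i\,u^i_\xi-u^k_\beta\left(\Gamma_A{}^\beta{}_\xi+\Gamma_A{}^\beta{}_i\,u^i_\xi\right).$$ Let $\ddot\Gamma\colon J^1(E,n)\to J^2(E,n)$ be the section such that $\ddot\Gamma(\theta)$ is the unique 2-jet $[L]^2_p$ over $\theta=[L]^1_p$ for which the tangent plane at $\theta$ of $L^{(1)}=\{[L]^1_q: q\in L\}$ is $\dot\Gamma$-horizontal. Similarly, let $\dot\Gamma_{\mathrm{pr}_M}=\mathrm{pr}_E^*(\Gamma)\otimes \mathrm{pr}_M^*(\Theta^*)$, a connection on $J^1\mathrm{pr}_M\cong \mathrm{pr}_E^*(TE)\otimes \mathrm{pr}_M^*(T^*M)\to M\times E$, and let $\ddot\Gamma_{\mathrm{pr}_M}\colon J^1\mathrm{pr}_M\to J^2\mathrm{pr}_M$ be the section such that $\ddot\Gamma_{\mathrm{pr}_M}(\tilde\theta)$ is the unique 2-jet $[s]^2_x$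 over $\tilde\theta=[s]^1_x$ for which the tangent plane at $\tilde\theta$ of $\{[s]^1_y\}$ is $\dot\Gamma_{\mathrm{pr}_M}$-horizontal; in charts, $$u^C_{x^\xi x^\lambda}+\Gamma_A{}^C{}_B\,u^A_{x^\xi}u^B_{x^\lambda}-\Theta_\xi{}^\eta{}_\lambda\,u^C_{x^\eta}=0.$$ Then $\ddot\Gamma_{\mathrm{pr}_M}$ maps $\mathrm{Imm}\,J^1\mathrm{pr}_M$ into $\mathrm{Imm}\,J^2\mathrm{pr}_M$, and $$\mathrm{pr}_E^{(2)}\circ\ddot\Gamma_{\mathrm{pr}_M}=\ddot\Gamma\circ\mathrm{pr}_E^{(1)}\qquad\text{on } \mathrm{Imm}\,J^1\mathrm{pr}_M .$$ In particular $\mathrm{pr}_E^{(2)}$ maps the equation of parametrized totally geodesic submanifolds $\mathcal S_{\mathrm{pr}_M}\subseteq\mathrm{Imm}\,J^2\mathrm{pr}_M$ (the jets with $\mathrm{II}_{\mathrm{pr}_M}=0$, i.e. satisfying the last displayed equation) into the equation of unparametrized totally geodesic submanifolds $\mathcal S\subseteq J^2(E,n)$ (the jets $[L]^2_p$ for which the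 second fundamental form $\mathrm{II}(X,Y)=[\nabla_X Y]\in T_pE/T_pL$ of $L$ at $p$ vanishes). -/

import Mathlib

open Set Filter Topology Manifold
open scoped ContDiff

namespace JetSubmfd

/-- The coordinate space `ℝᵏ`. -/
abbrev Eu (k : ℕ) : Type := EuclideanSpace ℝ (Fin k)

/-- A smooth torsion-free linear connection on the tangent bundle of a smooth `k`-manifold `N`. -/
structure TorsionFreeConnection (k : ℕ) (N : Type*) [TopologicalSpace N] [ChartedSpace (Eu k) N]
    [IsManifold (𝓡 k) ∞ N] where
  cov : CovariantDerivative (𝓡 k) (Eu k) (TangentSpace (𝓡 k) : N → Type _)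
  smooth : cov.ContMDiffCovariantDerivative ∞
  torsion_eq_zero : cov.torsion = 0

section Connection

variable {k : ℕ} {N : Type*} [TopologicalSpace N] [ChartedSpace (Eu k) N]
  {F : Type*} [NormedAddCommGroup F] [NormedSpace ℝ F]

/-- The vector field on `N` with constant components `w` in the coordinates `e`
(that is `∑ wⁱ ∂ᵢ`), as a field defined near every point at which `e` is a chart. -/
noncomputable def coordField (e : N → F) (w : F) (q : N) : TangentSpace (𝓡 k) q :=
  VectorField.mpullback (𝓡 k) 𝓘(ℝ, F) e (fun _ => w) q

/-- The Christoffel symbols at `p` in the coordinates `e`: the coordinate expression of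
`∇_{∂_v} ∂_w`, so that its components are `Γ_A{}^C{}_B v^A w^B`. -/
noncomputable def christoffel [IsManifold (𝓡 k) ∞ N] (Γ : TorsionFreeConnection k N)
   (e : N → F) (p : N) (v w : F) : F :=
  mfderiv (𝓡 k) 𝓘(ℝ, F) e p (Γ.cov (coordField e w) p (coordField e v p))

variable [IsManifold (𝓡 k) ∞ N]

theorem two_le_infty : (2 : WithTop ℕ∞) ≤ ∞ := ENat.LEInfty.out

theorem mdiff_const (w : F) (x : F) : MDifferentiableAt 𝓘(ℝ, F) (𝓘(ℝ, F).prod 𝓘(ℝ, F))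
   (fun y : F => (⟨y, w⟩ : Bundle.TotalSpace F (TangentSpace 𝓘(ℝ, F)))) x := by
  exact ((contMDiffAt_vectorSpace_iff_contDiffAt (𝕜 := ℝ) (n := 1)
    (V := fun _ : F => (w : F))).2 contDiffAt_const).mdifferentiableAt one_ne_zero

theorem mdiff_coordField {e : N → F} {p : N} (he : ContMDiffAt (𝓡 k) 𝓘(ℝ, F) ∞ e p)
    (hi : (mfderiv (𝓡 k) 𝓘(ℝ, F) e p).IsInvertible) (w : F) :
    MDifferentiableAt (𝓡 k) ((𝓡 k).prod (𝓡 k))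
      (fun q => (⟨q, coordField e w q⟩ : Bundle.TotalSpace (Eu k) (TangentSpace (𝓡 k)))) p := by
  have : IsManifold (𝓡 k) 2 N := inferInstance
  have := MDifferentiableAt.mpullback_vectorField (I := 𝓡 k) (I' := 𝓘(ℝ, F)) (f := e)
    (V := fun _ => w) (mdiff_const w (e p)) (he.of_le (m := 2) two_le_infty) hi le_rfl
  exact this

theorem christoffel_add_right (Γ : TorsionFreeConnection k N) {e : N → F} {p : N}
    (he : ContMDiffAt (𝓡 k) 𝓘(ℝ, F) ∞ e p)
    (hi : (mfderiv (𝓡 k) 𝓘(ℝ, F) e p).IsInvertible) (v w w' : F) :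
    christoffel Γ e p v (w + w') = christoffel Γ e p v w + christoffel Γ e p v w' := by
  have h1 : (coordField e (w + w') : Π q : N, TangentSpace (𝓡 k) q) = coordField e w + coordField e w' := by
    ext1 q
    exact ContinuousLinearMap.map_add
      (ContinuousLinearMap.inverse (mfderiv (𝓡 k) 𝓘(ℝ, F) e q) : F →L[ℝ] Eu k) w w'
  unfold christoffel
  rw [h1, Γ.cov.isCovariantDerivativeOnUniv.add (mdiff_coordField he hi w)
    (mdiff_coordField he hi w')]
  exact map_add _ _ _

theorem christoffel_smul_right (Γ : TorsionFreeConnection k N) {e : N → F} {p : N}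
    (he : ContMDiffAt (𝓡 k) 𝓘(ℝ, F) ∞ e p)
    (hi : (mfderiv (𝓡 k) 𝓘(ℝ, F) e p).IsInvertible) (c : ℝ) (v w : F) :
    christoffel Γ e p v (c • w) = c • christoffel Γ e p v w := by
  have h1 : (coordField e (c • w) : Π q : N, TangentSpace (𝓡 k) q) = c • coordField e w := by
    ext1 q
    exact map_smul
      (ContinuousLinearMap.inverse (mfderiv (𝓡 k) 𝓘(ℝ, F) e q) : F →L[ℝ] Eu k) c w
  unfold christoffel
  rw [h1, Γ.cov.isCovariantDerivativeOnUniv.smul_const _ (mdiff_coordField he hi w)]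
  exact map_smul (mfderiv (𝓡 k) 𝓘(ℝ, F) e p : Eu k →L[ℝ] F) c _

theorem christoffel_symm (Γ : TorsionFreeConnection k N) {e : N → F} {p : N}
    (he : ContMDiffAt (𝓡 k) 𝓘(ℝ, F) ∞ e p)
    (hi : (mfderiv (𝓡 k) 𝓘(ℝ, F) e p).IsInvertible) (v w : F) :
    christoffel Γ e p v w = christoffel Γ e p w v := by
  have h := (Γ.cov.torsion_eq_zero_iff.1 Γ.torsion_eq_zero)
    (mdiff_coordField he hi v) (mdiff_coordField he hi w)
  have hb : VectorField.mlieBracket (𝓡 k) (coordField e v) (coordField e w) p = 0 := by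
    have : IsManifold (𝓡 k) (minSmoothness ℝ 3) N := by
      simp only [minSmoothness_of_isRCLikeNormedField]; infer_instance
    have h2 := VectorField.mpullback_mlieBracket (I := 𝓡 k) (I' := 𝓘(ℝ, F)) (f := e) (n := ∞)
      (V := fun _ => v) (W := fun _ => w)
      (mdiff_const v (e p)) (mdiff_const w (e p)) he (by simpa using two_le_infty)
    refine h2.symm.trans ?_
    have h3 : VectorField.mlieBracket 𝓘(ℝ, F) (fun _ : F => v) (fun _ => w) = fun _ => 0 := by
      ext x
      exact (congrFun (VectorField.mlieBracketWithin_eq_lieBracketWithin (𝕜 := ℝ)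
        (V := fun _ : F => v) (W := fun _ => w) (s := univ)) x).trans
        (by simp [VectorField.lieBracketWithin]; rfl)
    unfold VectorField.mpullback
    rw [h3]
    exact ContinuousLinearMap.map_zero _
  rw [hb, sub_eq_zero] at h
  unfold christoffel
  rw [h]


theorem christoffel_add_left (Γ : TorsionFreeConnection k N) {e : N → F} {p : N}
    (he : ContMDiffAt (𝓡 k) 𝓘(ℝ, F) ∞ e p)
    (hi : (mfderiv (𝓡 k) 𝓘(ℝ, F) e p).IsInvertible) (v v' w : F) :
    christoffel Γ e p (v + v') w = christoffel Γ e p v w + christoffel Γ e p v' w := by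
  simp only [christoffel_symm Γ he hi _ w, christoffel_add_right Γ he hi]

theorem christoffel_smul_left (Γ : TorsionFreeConnection k N) {e : N → F} {p : N}
    (he : ContMDiffAt (𝓡 k) 𝓘(ℝ, F) ∞ e p)
    (hi : (mfderiv (𝓡 k) 𝓘(ℝ, F) e p).IsInvertible) (c : ℝ) (v w : F) :
    christoffel Γ e p (c • v) w = c • christoffel Γ e p v w := by
  simp only [christoffel_symm Γ he hi _ w, christoffel_smul_right Γ he hi]

end Connection

section Polynomial

variable {V W : Type*} [NormedAddCommGroup V] [NormedSpace ℝ V]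
  [NormedAddCommGroup W] [NormedSpace ℝ W]

theorem exists_bilin [FiniteDimensional ℝ V] (B : V → V → W) (h1 : ∀ a a' b, B (a + a') b = B a b + B a' b)
    (h2 : ∀ (c : ℝ) a b, B (c • a) b = c • B a b) (h3 : ∀ a b b', B a (b + b') = B a b + B a b')
    (h4 : ∀ (c : ℝ) a b, B a (c • b) = c • B a b) :
    ∃ Q : V →L[ℝ] V →L[ℝ] W, ∀ a b, Q a b = B a b :=
  ⟨LinearMap.toContinuousLinearMap ((LinearMap.toContinuousLinearMap :
    (V →ₗ[ℝ] W) ≃ₗ[ℝ] (V →L[ℝ] W)).toLinearMap ∘ₗ LinearMap.mk₂ ℝ B h1 h2 h3 h4),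
    fun a b => by simp⟩

theorem exists_quadratic (y₀ : V) (z₀ : W) (A : V →L[ℝ] W) (Q : V →L[ℝ] V →L[ℝ] W)
    (hQ : ∀ a b, Q a b = Q b a) :
    ∃ f : V → W, ContDiff ℝ ∞ f ∧ f y₀ = z₀ ∧ fderiv ℝ f y₀ = A ∧
      fderiv ℝ (fderiv ℝ f) y₀ = Q := by
  have hd : ∀ y, HasFDerivAt (fun y => z₀ + A (y - y₀) + (1 / 2 : ℝ) • Q (y - y₀) (y - y₀))
      (A + Q (y - y₀)) y := by
    intro y
    have h0 : HasFDerivAt (fun y : V => y - y₀) (ContinuousLinearMap.id ℝ V) y :=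
      (hasFDerivAt_id y).sub_const y₀
    have h1 := (A.hasFDerivAt.comp y h0).const_add z₀
    have h2 := ((Q.hasFDerivAt.comp y h0).clm_apply h0).const_smul (1 / 2 : ℝ)
    refine (h1.add h2).congr_fderiv ?_
    ext b
    simp
    rw [hQ b y, hQ b y₀, ← two_smul ℝ, smul_smul]; norm_num
  refine ⟨_, ?_, ?_, (hd y₀).fderiv.trans (by simp), ?_⟩
  · fun_prop
  · simp
  · rw [show fderiv ℝ (fun y => z₀ + A (y - y₀) + (1 / 2 : ℝ) • Q (y - y₀) (y - y₀)) =
      fun y => A + Q (y - y₀) from funext fun y => (hd y).fderiv]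
    have h0 : HasFDerivAt (fun y : V => y - y₀) (ContinuousLinearMap.id ℝ V) y₀ :=
      (hasFDerivAt_id y₀).sub_const y₀
    refine ((Q.hasFDerivAt.comp y₀ h0).const_add A).fderiv.trans ?_
    ext; simp

theorem iteratedFDeriv_eq_of_le_one {f g : V → W} {y : V} (h0 : f y = g y)
    (h1 : fderiv ℝ f y = fderiv ℝ g y) (k : ℕ) (hk : k ≤ 1) :
    iteratedFDeriv ℝ k f y = iteratedFDeriv ℝ k g y := by
  interval_cases k
  · ext v; simp [h0]
  · ext v; simp [iteratedFDeriv_one_apply, h1]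

end Polynomial

section SubmanifoldJets

variable (n m : ℕ) (E : Type*) [TopologicalSpace E] [ChartedSpace (Eu (n + m)) E]

/-- A divided chart `(u^λ, u^i)` on the `(n+m)`-manifold `E`: a chart of the smooth structure whose
coordinate space is split as `ℝⁿ × ℝᵐ`. -/
structure DividedChart where
  chart : OpenPartialHomeomorph E (Eu (n + m))
  chart_mem : chart ∈ IsManifold.maximalAtlas (𝓡 (n + m)) ∞ E
  split : Eu (n + m) ≃L[ℝ] Eu n × Eu m

variable {n m E}

/-- The coordinates `((u^λ), (u^i))` of a divided chart (meaningful on `u.chart.source`). -/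
def DividedChart.coord (u : DividedChart n m E) (q : E) : Eu n × Eu m := u.split (u.chart q)

theorem DividedChart.contMDiffAt [IsManifold (𝓡 (n + m)) ∞ E] (u : DividedChart n m E) {p : E}
    (hp : p ∈ u.chart.source) :
    ContMDiffAt (𝓡 (n + m)) 𝓘(ℝ, Eu n × Eu m) ∞ u.coord p :=
  u.split.contDiff.contMDiff.contMDiffAt.comp p (contMDiffAt_of_mem_maximalAtlas u.chart_mem hp)

theorem chart_mfderiv_isInvertible {k : ℕ} {N : Type*} [TopologicalSpace N]
    [ChartedSpace (Eu k) N] {e : OpenPartialHomeomorph N (Eu k)}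
    (he : e ∈ IsManifold.maximalAtlas (𝓡 k) ∞ N) {p : N} (hp : p ∈ e.source) :
    (mfderiv (𝓡 k) 𝓘(ℝ, Eu k) e p).IsInvertible := by
  have h : e.MDifferentiable (𝓡 k) (𝓡 k) :=
    ⟨(contMDiffOn_of_mem_maximalAtlas he).mdifferentiableOn (by simp),
      (contMDiffOn_symm_of_mem_maximalAtlas he).mdifferentiableOn (by simp)⟩
  exact ⟨h.mfderiv hp, rfl⟩

theorem DividedChart.isInvertible [IsManifold (𝓡 (n + m)) ∞ E] (u : DividedChart n m E) {p : E}
    (hp : p ∈ u.chart.source) :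
    (mfderiv (𝓡 (n + m)) 𝓘(ℝ, Eu n × Eu m) u.coord p).IsInvertible := by
  have h := chart_mfderiv_isInvertible u.chart_mem hp
  have h2 : mfderiv (𝓡 (n + m)) 𝓘(ℝ, Eu n × Eu m) u.coord p =
      (u.split : Eu (n + m) →L[ℝ] Eu n × Eu m) ∘L mfderiv (𝓡 (n + m)) 𝓘(ℝ, Eu (n + m)) u.chart p := by
    have h3 := mfderiv_comp p (I := 𝓡 (n + m)) (I' := 𝓘(ℝ, Eu (n + m)))
      (I'' := 𝓘(ℝ, Eu n × Eu m)) (g := u.split) (f := u.chart)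
      u.split.differentiableAt.mdifferentiableAt
      ((contMDiffAt_of_mem_maximalAtlas u.chart_mem hp).mdifferentiableAt (by simp))
    refine h3.trans ?_
    rw [mfderiv_eq_fderiv, u.split.fderiv]
    rfl
  rw [h2]
  exact (ContinuousLinearMap.isInvertible_equiv (f := u.split)).comp h

/-- The divided chart `u` is concordant to `L` at `p`: near `p` the set `L` is described by
`u^i = f^i(u^1, …, u^n)` with `f` smooth near the point in question. -/
def DividedChart.IsGraphAt (u : DividedChart n m E) (L : Set E) (p : E) (f : Eu n → Eu m) : Prop :=
  p ∈ u.chart.source ∧ (∀ᶠ x in 𝓝 (u.coord p).1, ContDiffAt ℝ ∞ f x) ∧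
    ∀ᶠ q in 𝓝 p, (q ∈ L ↔ (u.coord q).2 = f (u.coord q).1)

variable (n m E) in
/-- An `n`-dimensional embedded smooth submanifold of `E`: near each of its points it is the graph of
a smooth map in a divided chart. -/
structure Submanifold where
  carrier : Set E
  exists_isGraphAt : ∀ p ∈ carrier, ∃ (u : DividedChart n m E) (f : Eu n → Eu m),
    u.IsGraphAt carrier p f

variable (n m E) in
/-- An `n`-dimensional embedded submanifold together with one of its points. -/
structure PointedSubmanifold where
  sub : Submanifold n m E
  pt : E
  pt_mem : pt ∈ sub.carrier

/-- `L` and `L'` have a contact of order `r` at `p`: in a divided chart concordant to both, the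
functions `f`, `f'` describing them have the same derivatives at `p` up to order `r`. By the
invariance of contact under coordinate changes this is an equivalence relation and it does not
matter which such chart is used. -/
def HasContact (r : ℕ) (P P' : PointedSubmanifold n m E) : Prop :=
  P.pt = P'.pt ∧ ∃ (u : DividedChart n m E) (f f' : Eu n → Eu m),
    u.IsGraphAt P.sub.carrier P.pt f ∧ u.IsGraphAt P'.sub.carrier P.pt f' ∧
    ∀ k ≤ r, iteratedFDeriv ℝ k f (u.coord P.pt).1 = iteratedFDeriv ℝ k f' (u.coord P.pt).1

variable (n m E) in
/-- The space `J^r(E,n)` of `r`-jets `[L]^r_p` of `n`-dimensional submanifolds of `E`. -/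
def SubJet (r : ℕ) : Type _ := Quot (HasContact (n := n) (m := m) (E := E) r)

/-- The jet `[L]^r_p`. -/
def SubJet.mk (r : ℕ) (P : PointedSubmanifold n m E) : SubJet n m E r := Quot.mk _ P

/-- The projection `π_{k,h} : J^k(E,n) → J^h(E,n)`. -/
def SubJet.proj {h k : ℕ} (hk : h ≤ k) : SubJet n m E k → SubJet n m E h :=
  Quot.map id fun _ _ ⟨hp, u, f, f', hf, hf', hd⟩ =>
    ⟨hp, u, f, f', hf, hf', fun j hj => hd j (hj.trans hk)⟩

/-- The inclusion `D¹` of the tautological (pseudo-horizontal) bundle at the `1`-jet with derivative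
coordinates `P = (u^i_λ)`: it sends `∂_λ` to `∂_λ + u^i_λ ∂_i`. Its range is the tangent plane. -/
def horLift (P : Eu n →L[ℝ] Eu m) (a : Eu n) : Eu n × Eu m := (a, P a)

/-- The projection `ω` of a tangent space of `E` onto its quotient by the tangent plane with
derivative coordinates `P`, the quotient being identified with `ℝᵐ` through the basis `[∂_i]`. -/
def vertProj (P : Eu n →L[ℝ] Eu m) (y : Eu n × Eu m) : Eu m := y.2 - P y.1

/-- The connection `Γ̇` on `J¹(E,n) → E`, through its vertical form. At the `1`-jet over `p` with
derivative coordinates `P` in the divided chart `u`, it sends the tangent vector of `J¹(E,n)` with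
components `(v, P')` to the homomorphism `a ↦ ω (∇_{(v, P')} (D¹ a))` from the tangent plane to its
quotient: the covariant derivative of `D¹` along that tangent vector, projected by `ω`.
In components, `(P')^k_ξ + Γ̇_A{}^k{}_ξ v^A` with
`Γ̇_A{}^k{}_ξ = Γ_A{}^k{}_ξ + Γ_A{}^k{}_i u^i_ξ - u^k_β (Γ_A{}^β{}_ξ + Γ_A{}^β{}_i u^i_ξ)`. -/
noncomputable def dotVertical [IsManifold (𝓡 (n + m)) ∞ E] (Γ : TorsionFreeConnection (n + m) E)
    (u : DividedChart n m E) (p : E) (P : Eu n →L[ℝ] Eu m)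
    (v : Eu n × Eu m) (P' : Eu n →L[ℝ] Eu m) (a : Eu n) : Eu m :=
  vertProj P ((0, P' a) + christoffel Γ u.coord p v (horLift P a))

/-- The `R`-plane of the `2`-jet `θ = [L]²_p`, i.e. the tangent plane at `[L]¹_p` of the prolonged
submanifold `L⁽¹⁾ ⊆ J¹(E,n)`, is horizontal for `Γ̇`. In a concordant divided chart this plane
consists of the vectors with components `(D¹ b, D²f(b))`. In other words `D²(θ)` is the contraction
of `D¹` with `Γ̇`. The condition does not depend on the representative or on the chart. -/
def IsDotHorizontal [IsManifold (𝓡 (n + m)) ∞ E] (Γ : TorsionFreeConnection (n + m) E)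
    (θ : SubJet n m E 2) : Prop :=
  ∃ (L : PointedSubmanifold n m E) (u : DividedChart n m E) (f : Eu n → Eu m),
    SubJet.mk 2 L = θ ∧ u.IsGraphAt L.sub.carrier L.pt f ∧
    ∀ b a : Eu n, dotVertical Γ u L.pt (fderiv ℝ f (u.coord L.pt).1)
      (horLift (fderiv ℝ f (u.coord L.pt).1) b)
      (fderiv ℝ (fderiv ℝ f) (u.coord L.pt).1 b) a = 0

/-- Existence of the jet defining `Γ̈(θ)`. -/
theorem exists_ddotGamma [IsManifold (𝓡 (n + m)) ∞ E] (Γ : TorsionFreeConnection (n + m) E)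
    (θ : SubJet n m E 1) :
    ∃ θ₂ : SubJet n m E 2, SubJet.proj one_le_two θ₂ = θ ∧ IsDotHorizontal Γ θ₂ := by
  induction θ using Quot.ind with | mk L =>
  obtain ⟨u, f, hu⟩ := L.sub.exists_isGraphAt L.pt L.pt_mem
  set x₀ := (u.coord L.pt).1 with hx₀
  set P := fderiv ℝ f x₀ with hP
  have he := u.contMDiffAt hu.1
  have hi := u.isInvertible hu.1
  have hl : ∀ a a', horLift P (a + a') = horLift P a + horLift P a' := by
    intro a a'; simp [horLift]
  have hs : ∀ (c : ℝ) a, horLift P (c • a) = c • horLift P a := by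
    intro a a'; simp [horLift]
  have hl' : ∀ a a', vertProj P (a + a') = vertProj P a + vertProj P a' := by
    intro a a'; simp [vertProj]; abel
  have hs' : ∀ (c : ℝ) a, vertProj P (c • a) = c • vertProj P a := by
    intro a a'; simp [vertProj, smul_sub]
  obtain ⟨Q, hQ⟩ := exists_bilin
    (fun b a : Eu n => -vertProj P (christoffel Γ u.coord L.pt (horLift P b) (horLift P a)))
    (fun b b' a => by rw [hl, christoffel_add_left Γ he hi, hl', neg_add])
    (fun c b a => by rw [hs, christoffel_smul_left Γ he hi, hs', smul_neg])
    (fun b a a' => by rw [hl, christoffel_add_right Γ he hi, hl', neg_add])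
    (fun c b a => by rw [hs, christoffel_smul_right Γ he hi, hs', smul_neg])
  obtain ⟨g, hg, hg0, hg1, hg2⟩ := exists_quadratic x₀ (f x₀) P Q
    (fun a b => by rw [hQ, hQ, christoffel_symm Γ he hi])
  have hpL : (u.coord L.pt).2 = f x₀ := (hu.2.2.self_of_nhds).1 L.pt_mem
  have hG : ∀ p ∈ u.chart.source,
      u.IsGraphAt {q | q ∈ u.chart.source ∧ (u.coord q).2 = g (u.coord q).1} p g := by
    intro p hp
    refine ⟨hp, Eventually.of_forall fun _ => hg.contDiffAt, ?_⟩
    filter_upwards [u.chart.open_source.mem_nhds hp] with q hq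
    exact ⟨fun h => h.2, fun h => ⟨hq, h⟩⟩
  let L' : PointedSubmanifold n m E :=
    { sub := ⟨{q | q ∈ u.chart.source ∧ (u.coord q).2 = g (u.coord q).1},
        fun p hp => ⟨u, g, hG p hp.1⟩⟩
      pt := L.pt
      pt_mem := ⟨hu.1, by rw [hpL, ← hx₀, hg0]⟩ }
  refine ⟨SubJet.mk 2 L', Quot.sound ⟨rfl, u, g, f, hG L.pt hu.1, hu, ?_⟩, L', u, g, rfl,
    hG L.pt hu.1, ?_⟩
  · exact iteratedFDeriv_eq_of_le_one hg0 hg1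
  · intro b a
    simp only [L', ← hx₀, hg1, hg2, dotVertical, hl', hQ]
    simp [vertProj]

/-- The section `Γ̈ : J¹(E,n) → J²(E,n)` of `π_{2,1}` associated with `Γ̇`: `Γ̈(θ)` is the (unique)
`2`-jet over `θ` whose `R`-plane is the `Γ̇`-horizontal lift of the tangent plane `θ`, that is
`D² ∘ Γ̈ = D¹ ⌟ Γ̇`. -/
noncomputable def ddotGamma [IsManifold (𝓡 (n + m)) ∞ E] (Γ : TorsionFreeConnection (n + m) E)
    (θ : SubJet n m E 1) : SubJet n m E 2 := (exists_ddotGamma Γ θ).choose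

theorem ddotGamma_spec [IsManifold (𝓡 (n + m)) ∞ E] (Γ : TorsionFreeConnection (n + m) E)
    (θ : SubJet n m E 1) :
    SubJet.proj one_le_two (ddotGamma Γ θ) = θ ∧ IsDotHorizontal Γ (ddotGamma Γ θ) :=
  (exists_ddotGamma Γ θ).choose_spec

/-- The universal second fundamental form `II(X, Y) = ω (∇_X̃ Y)` at the `2`-jet over `p` with first
and second derivative coordinates `P`, `P₂` in the divided chart `u`; `X`, `Y` stand for the
pseudo-horizontal vectors `D¹ X`, `D¹ Y`. -/
noncomputable def secondFundamentalForm [IsManifold (𝓡 (n + m)) ∞ E]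
    (Γ : TorsionFreeConnection (n + m) E) (u : DividedChart n m E) (p : E)
    (P : Eu n →L[ℝ] Eu m) (P₂ : Eu n →L[ℝ] Eu n →L[ℝ] Eu m) (X Y : Eu n) : Eu m :=
  vertProj P ((0, P₂ X Y) + christoffel Γ u.coord p (horLift P X) (horLift P Y))

/-- The equation `S ⊆ J²(E,n)` of unparametrized totally geodesic submanifolds: `II = 0`. -/
def geodesicEquation [IsManifold (𝓡 (n + m)) ∞ E] (Γ : TorsionFreeConnection (n + m) E) :
    Set (SubJet n m E 2) :=
  {θ | ∃ (L : PointedSubmanifold n m E) (u : DividedChart n m E) (f : Eu n → Eu m),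
    SubJet.mk 2 L = θ ∧ u.IsGraphAt L.sub.carrier L.pt f ∧
    ∀ X Y : Eu n, secondFundamentalForm Γ u L.pt (fderiv ℝ f (u.coord L.pt).1)
      (fderiv ℝ (fderiv ℝ f) (u.coord L.pt).1) X Y = 0}

end SubmanifoldJets

section SectionJets

variable (n m : ℕ) (M E : Type*) [TopologicalSpace M] [ChartedSpace (Eu n) M]
  [TopologicalSpace E] [ChartedSpace (Eu (n + m)) E]

/-- A local section `x ↦ (x, s(x))` of `pr_M : M × E → M`, i.e. a smooth map `s` from an open subset
of `M` to `E`, together with a point of its domain. The values of `toFun` outside `domain` are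
irrelevant. -/
structure PointedSection where
  domain : Set M
  isOpen_domain : IsOpen domain
  toFun : M → E
  contMDiffOn : ContMDiffOn (𝓡 n) (𝓡 (n + m)) ∞ toFun domain
  pt : M
  pt_mem : pt ∈ domain

variable {n m M E}

/-- The point `s(x) ∈ E`. -/
def PointedSection.val (s : PointedSection n m M E) : E := s.toFun s.pt

/-- The local section is an immersion of its domain into `E` (a parametrized submanifold). -/
def PointedSection.IsImmersion (s : PointedSection n m M E) : Prop :=
  ∀ x ∈ s.domain, IsImmersionAt (𝓡 n) (𝓡 (n + m)) ∞ s.toFun x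

/-- `ψ` and `φ` are charts of the smooth structures of `M` and `E` around `x` and `s(x)`. -/
structure PointedSection.IsChartPair (s : PointedSection n m M E)
    (ψ : OpenPartialHomeomorph M (Eu n)) (φ : OpenPartialHomeomorph E (Eu (n + m))) : Prop where
  dom_mem : ψ ∈ IsManifold.maximalAtlas (𝓡 n) ∞ M
  cod_mem : φ ∈ IsManifold.maximalAtlas (𝓡 (n + m)) ∞ E
  pt_mem : s.pt ∈ ψ.source
  val_mem : s.val ∈ φ.source

/-- The coordinate expression `u^A = s^A(x^1, …, x^n)` of `s`. -/
def PointedSection.localRep (s : PointedSection n m M E)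
    (ψ : OpenPartialHomeomorph M (Eu n)) (φ : OpenPartialHomeomorph E (Eu (n + m))) :
    Eu n → Eu (n + m) := φ ∘ s.toFun ∘ ψ.symm

/-- Two local sections have the same `r`-jet: same point `x`, same value `s(x)`, and in charts the
same derivatives at `x` up to order `r`. By the chain rule this is an equivalence relation and it
does not matter which charts are used. -/
def HasSameJet (r : ℕ) (s s' : PointedSection n m M E) : Prop :=
  s.pt = s'.pt ∧ s.val = s'.val ∧
    ∃ (ψ : OpenPartialHomeomorph M (Eu n)) (φ : OpenPartialHomeomorph E (Eu (n + m))),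
      s.IsChartPair ψ φ ∧ ∀ k ≤ r,
        iteratedFDeriv ℝ k (s.localRep ψ φ) (ψ s.pt) =
          iteratedFDeriv ℝ k (s'.localRep ψ φ) (ψ s.pt)

variable (n m M E) in
/-- The `r`-jet bundle `J^r pr_M` of `pr_M : M × E → M`. -/
def SecJet (r : ℕ) : Type _ := Quot (HasSameJet (n := n) (m := m) (M := M) (E := E) r)

/-- The jet `[s]^r_x`. -/
def SecJet.mk (r : ℕ) (s : PointedSection n m M E) : SecJet n m M E r := Quot.mk _ s

/-- The projection `J^k pr_M → J^h pr_M`. -/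
def SecJet.proj {h k : ℕ} (hk : h ≤ k) : SecJet n m M E k → SecJet n m M E h :=
  Quot.map id fun _ _ ⟨hp, hv, ψ, φ, hc, hd⟩ =>
    ⟨hp, hv, ψ, φ, hc, fun j hj => hd j (hj.trans hk)⟩

variable (n m M E) in
/-- The subset `Imm J^r pr_M ⊆ J^r pr_M` of `r`-jets of immersions. -/
def ImmJet (r : ℕ) : Set (SecJet n m M E r) :=
  {θ | ∃ s : PointedSection n m M E, s.IsImmersion ∧ SecJet.mk r s = θ}

/-- The connection `Γ̇_{pr_M} = pr_E^*(Γ) ⊗ pr_M^*(Θ^*)` on `J¹ pr_M ≅ pr_E^*(TE) ⊗ pr_M^*(T^*M)`, through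
its vertical form. At the `1`-jet over `(x, p)` with derivative coordinates `A = (u^C_{x^λ})` it sends
the tangent vector with components `(x', v, A')` to `a ↦ A' a + Γ(v, A a) - A (Θ(x', a))`. -/
noncomputable def dotVerticalSec [IsManifold (𝓡 n) ∞ M] [IsManifold (𝓡 (n + m)) ∞ E]
    (Γ : TorsionFreeConnection (n + m) E) (Θ : TorsionFreeConnection n M)
    (ψ : OpenPartialHomeomorph M (Eu n)) (φ : OpenPartialHomeomorph E (Eu (n + m)))
    (x : M) (p : E) (A : Eu n →L[ℝ] Eu (n + m))
    (x' : Eu n) (v : Eu (n + m)) (A' : Eu n →L[ℝ] Eu (n + m)) (a : Eu n) : Eu (n + m) :=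
  A' a + christoffel Γ φ p v (A a) - A (christoffel Θ ψ x x' a)

/-- The `R`-plane of the `2`-jet `θ = [s]²_x`, i.e. the tangent plane at `[s]¹_x` of the image of the
first prolongation of `s`, is horizontal for `Γ̇_{pr_M}`. In charts this plane consists of the vectors
with components `(b, Ds(b), D²s(b))`. The condition does not depend on the representative or on the
charts. -/
def IsDotHorizontalSec [IsManifold (𝓡 n) ∞ M] [IsManifold (𝓡 (n + m)) ∞ E]
    (Γ : TorsionFreeConnection (n + m) E) (Θ : TorsionFreeConnection n M)
    (θ : SecJet n m M E 2) : Prop :=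
  ∃ (s : PointedSection n m M E)
    (ψ : OpenPartialHomeomorph M (Eu n)) (φ : OpenPartialHomeomorph E (Eu (n + m))),
    SecJet.mk 2 s = θ ∧ s.IsChartPair ψ φ ∧
    ∀ b a : Eu n, dotVerticalSec Γ Θ ψ φ s.pt s.val (fderiv ℝ (s.localRep ψ φ) (ψ s.pt))
      b (fderiv ℝ (s.localRep ψ φ) (ψ s.pt) b)
      (fderiv ℝ (fderiv ℝ (s.localRep ψ φ)) (ψ s.pt) b) a = 0

/-- Existence of the jet defining `Γ̈_{pr_M}(θ)`. -/
theorem exists_ddotGammaSec [IsManifold (𝓡 n) ∞ M] [IsManifold (𝓡 (n + m)) ∞ E]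
    (Γ : TorsionFreeConnection (n + m) E) (Θ : TorsionFreeConnection n M)
    (θ : SecJet n m M E 1) :
    ∃ θ₂ : SecJet n m M E 2, SecJet.proj one_le_two θ₂ = θ ∧ IsDotHorizontalSec Γ Θ θ₂ := by
  induction θ using Quot.ind with | mk s =>
  set ψ := chartAt (Eu n) s.pt
  set φ := chartAt (Eu (n + m)) s.val
  have hψ : ψ ∈ IsManifold.maximalAtlas (𝓡 n) ∞ M := IsManifold.chart_mem_maximalAtlas _
  have hφ : φ ∈ IsManifold.maximalAtlas (𝓡 (n + m)) ∞ E := IsManifold.chart_mem_maximalAtlas _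
  have hx : s.pt ∈ ψ.source := mem_chart_source _ _
  have hp : s.val ∈ φ.source := mem_chart_source _ _
  set A := fderiv ℝ (s.localRep ψ φ) (ψ s.pt)
  have he := contMDiffAt_of_mem_maximalAtlas hφ hp
  have hi := chart_mfderiv_isInvertible hφ hp
  have he' := contMDiffAt_of_mem_maximalAtlas hψ hx
  have hi' := chart_mfderiv_isInvertible hψ hx
  obtain ⟨Q, hQ⟩ := exists_bilin
    (fun b a : Eu n => A (christoffel Θ ψ s.pt b a) - christoffel Γ φ s.val (A b) (A a))
    (fun b b' a => by
      rw [map_add, christoffel_add_left Γ he hi, christoffel_add_left Θ he' hi', map_add]; abel)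
    (fun c b a => by
      rw [map_smul, christoffel_smul_left Γ he hi, christoffel_smul_left Θ he' hi', map_smul,
        smul_sub])
    (fun b a a' => by
      rw [map_add, christoffel_add_right Γ he hi, christoffel_add_right Θ he' hi', map_add]; abel)
    (fun c b a => by
      rw [map_smul, christoffel_smul_right Γ he hi, christoffel_smul_right Θ he' hi', map_smul,
        smul_sub])
  obtain ⟨g, hg, hg0, hg1, hg2⟩ := exists_quadratic (ψ s.pt) (φ s.val) A Q
    (fun a b => by rw [hQ, hQ, christoffel_symm Γ he hi, christoffel_symm Θ he' hi'])
  let s' : PointedSection n m M E :=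
    { domain := ψ.source ∩ ψ ⁻¹' (g ⁻¹' φ.target)
      isOpen_domain := ψ.isOpen_inter_preimage (φ.open_target.preimage hg.continuous)
      toFun := φ.symm ∘ g ∘ ψ
      contMDiffOn := by
        refine (contMDiffOn_symm_of_mem_maximalAtlas hφ).comp
          (hg.contMDiff.comp_contMDiffOn ((contMDiffOn_of_mem_maximalAtlas hψ).mono
            inter_subset_left)) ?_
        intro y hy
        exact hy.2
      pt := s.pt
      pt_mem := ⟨hx, by simpa [hg0] using φ.map_source hp⟩ }
  have hval : s'.val = s.val := by
    simp [s', PointedSection.val, hg0]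
    exact φ.left_inv hp
  have hc : s.IsChartPair ψ φ := ⟨hψ, hφ, hx, hp⟩
  have hc' : s'.IsChartPair ψ φ := ⟨hψ, hφ, hx, by rw [hval]; exact hp⟩
  have hloc : s'.localRep ψ φ =ᶠ[𝓝 (ψ s.pt)] g := by
    have h1 : g ⁻¹' φ.target ∈ 𝓝 (ψ s.pt) :=
      (φ.open_target.preimage hg.continuous).mem_nhds (by simpa [hg0] using φ.map_source hp)
    filter_upwards [h1, ψ.open_target.mem_nhds (ψ.map_source hx)] with y hy hy'
    simp only [PointedSection.localRep, s', Function.comp, ψ.right_inv hy']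
    exact φ.right_inv hy
  have hd1 : fderiv ℝ (s'.localRep ψ φ) (ψ s.pt) = A := hloc.fderiv_eq.trans hg1
  have hd2 : fderiv ℝ (fderiv ℝ (s'.localRep ψ φ)) (ψ s.pt) = Q :=
    hloc.fderiv.fderiv_eq.trans hg2
  refine ⟨SecJet.mk 2 s', Quot.sound ⟨rfl, hval, ψ, φ, hc', ?_⟩, s', ψ, φ, rfl, hc', ?_⟩
  · refine iteratedFDeriv_eq_of_le_one ?_ hd1
    refine hloc.self_of_nhds.trans (hg0.trans ?_)
    simp only [PointedSection.localRep, Function.comp, PointedSection.val]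
    exact congrArg (fun y => φ (s.toFun y)) (ψ.left_inv hx).symm
  · intro b a
    have e1 : s'.pt = s.pt := rfl
    rw [e1, hd1, hd2, hval]
    simp [dotVerticalSec, hQ]

/-- The section `Γ̈_{pr_M} : J¹ pr_M → J² pr_M` associated with `Γ̇_{pr_M}`: `Γ̈_{pr_M}(θ)` is the (unique)
`2`-jet over `θ` whose `R`-plane is horizontal for `Γ̇_{pr_M}`. -/
noncomputable def ddotGammaSec [IsManifold (𝓡 n) ∞ M] [IsManifold (𝓡 (n + m)) ∞ E]
    (Γ : TorsionFreeConnection (n + m) E) (Θ : TorsionFreeConnection n M)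
    (θ : SecJet n m M E 1) : SecJet n m M E 2 := (exists_ddotGammaSec Γ Θ θ).choose

theorem ddotGammaSec_spec [IsManifold (𝓡 n) ∞ M] [IsManifold (𝓡 (n + m)) ∞ E]
    (Γ : TorsionFreeConnection (n + m) E) (Θ : TorsionFreeConnection n M)
    (θ : SecJet n m M E 1) :
    SecJet.proj one_le_two (ddotGammaSec Γ Θ θ) = θ ∧
      IsDotHorizontalSec Γ Θ (ddotGammaSec Γ Θ θ) :=
  (exists_ddotGammaSec Γ Θ θ).choose_spec

/-- The form `II_{pr_M}(X, Y)` at the `2`-jet over `(x, p)` with first and second derivative coordinates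
`A`, `A₂`: in components `u^C_{x^ξ x^λ} + Γ_A{}^C{}_B u^A_{x^ξ} u^B_{x^λ} - Θ_ξ{}^η{}_λ u^C_{x^η}`. -/
noncomputable def secondFundamentalFormSec [IsManifold (𝓡 n) ∞ M] [IsManifold (𝓡 (n + m)) ∞ E]
    (Γ : TorsionFreeConnection (n + m) E) (Θ : TorsionFreeConnection n M)
    (ψ : OpenPartialHomeomorph M (Eu n)) (φ : OpenPartialHomeomorph E (Eu (n + m)))
    (x : M) (p : E) (A : Eu n →L[ℝ] Eu (n + m)) (A₂ : Eu n →L[ℝ] Eu n →L[ℝ] Eu (n + m))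
    (X Y : Eu n) : Eu (n + m) :=
  A₂ X Y + christoffel Γ φ p (A X) (A Y) - A (christoffel Θ ψ x X Y)

/-- The equation `S_{pr_M} ⊆ Imm J² pr_M` of parametrized totally geodesic submanifolds:
`II_{pr_M} = 0`. -/
def geodesicEquationSec [IsManifold (𝓡 n) ∞ M] [IsManifold (𝓡 (n + m)) ∞ E]
    (Γ : TorsionFreeConnection (n + m) E) (Θ : TorsionFreeConnection n M) :
    Set (ImmJet n m M E 2) :=
  {θ | ∃ (s : PointedSection n m M E)
    (ψ : OpenPartialHomeomorph M (Eu n)) (φ : OpenPartialHomeomorph E (Eu (n + m))),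
    SecJet.mk 2 s = θ.1 ∧ s.IsChartPair ψ φ ∧
    ∀ X Y : Eu n, secondFundamentalFormSec Γ Θ ψ φ s.pt s.val
      (fderiv ℝ (s.localRep ψ φ) (ψ s.pt))
      (fderiv ℝ (fderiv ℝ (s.localRep ψ φ)) (ψ s.pt)) X Y = 0}

/-- An immersion maps a small neighbourhood of the given point onto an embedded submanifold. -/
theorem PointedSection.exists_image (s : PointedSection n m M E) (hs : s.IsImmersion) :
    ∃ (U : Set M) (L : PointedSubmanifold n m E), IsOpen U ∧ s.pt ∈ U ∧ U ⊆ s.domain ∧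
      L.sub.carrier = s.toFun '' U ∧ L.pt = s.val := by
  have h := hs s.pt s.pt_mem
  set ψ := h.domChart
  set φ := h.codChart
  have hψ := h.mem_domChart_source
  have hw : ∀ x ∈ ψ.source, φ (s.toFun x) = h.equiv (ψ x, 0) := by
    intro x hx
    have hmem : ψ x ∈ (h.domChart.extend (𝓡 n)).target := by
      rw [OpenPartialHomeomorph.extend_target]
      simpa using ψ.map_source hx
    have := h.writtenInCharts hmem
    simp only [Function.comp, OpenPartialHomeomorph.extend_coe,
      OpenPartialHomeomorph.extend_coe_symm] at this
    have hinv : h.domChart.symm (ψ x) = x := ψ.left_inv hx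
    simp [hinv] at this
    exact this
  have hsub : ∀ x ∈ ψ.source, s.toFun x ∈ φ.source := fun x hx => h.source_subset_preimage_source hx
  have : FiniteDimensional ℝ (Eu n × h.complement) := h.equiv.symm.toLinearEquiv.finiteDimensional
  have : FiniteDimensional ℝ h.complement :=
    FiniteDimensional.of_surjective (LinearMap.snd ℝ (Eu n) h.complement)
      LinearMap.snd_surjective
  have hfr : Module.finrank ℝ h.complement = Module.finrank ℝ (Eu m) := by
    have := h.equiv.toLinearEquiv.finrank_eq
    simp [Module.finrank_prod] at this ⊢
    exact this
  let g : h.complement ≃L[ℝ] Eu m := ContinuousLinearEquiv.ofFinrankEq hfr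
  let u : DividedChart n m E :=
    { chart := φ
      chart_mem := h.codChart_mem_maximalAtlas
      split := h.equiv.symm.trans ((ContinuousLinearEquiv.refl ℝ (Eu n)).prodCongr g) }
  have hu : ∀ x ∈ ψ.source, u.coord (s.toFun x) = (ψ x, 0) := by
    intro x hx
    simp [DividedChart.coord, u, hw x hx]
  have hinj : ∀ q ∈ φ.source, ∀ q' ∈ φ.source, u.coord q = u.coord q' → q = q' := by
    intro q hq q' hq' hqq
    exact φ.injOn hq hq' (u.split.injective hqq)
  set U := ψ.source ∩ s.domain with hU
  have hUo : IsOpen U := ψ.open_source.inter s.isOpen_domain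
  have key : ∀ p ∈ s.toFun '' U, u.IsGraphAt (s.toFun '' U) p (fun _ => 0) := by
    rintro p ⟨x, hx, rfl⟩
    refine ⟨hsub x hx.1, Eventually.of_forall fun _ => contDiffAt_const, ?_⟩
    have hopen : IsOpen (ψ '' U) := ψ.isOpen_image_of_subset_source hUo inter_subset_left
    have hcont : ContinuousAt (fun q => (u.coord q).1) (s.toFun x) :=
      (continuous_fst.comp u.split.continuous).continuousAt.comp
        (φ.continuousAt (hsub x hx.1))
    have hn : (fun q => (u.coord q).1) ⁻¹' (ψ '' U) ∈ 𝓝 (s.toFun x) :=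
      hcont (hopen.mem_nhds ⟨x, hx, by simp [hu x hx.1]⟩)
    filter_upwards [hn, φ.open_source.mem_nhds (hsub x hx.1)] with q hq hqs
    constructor
    · rintro ⟨y, hy, rfl⟩
      simp [hu y hy.1]
    · intro h0
      obtain ⟨y, hy, hyq⟩ := hq
      refine ⟨y, hy, hinj _ (hsub y hy.1) _ hqs ?_⟩
      rw [hu y hy.1, hyq, ← h0]
  exact ⟨U, ⟨⟨s.toFun '' U, fun p hp => ⟨u, _, key p hp⟩⟩, s.val, s.pt, ⟨hψ, s.pt_mem⟩, rfl⟩, hUo,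
    ⟨hψ, s.pt_mem⟩, inter_subset_right, rfl, rfl⟩

/-- `θ' = [s(U)]^r_{s(x)}` for some immersion `s` with `[s]^r_x = θ` and some open neighbourhood `U` of
`x` on which the image of `s` is an embedded submanifold. The jet `θ'` depends only on `θ`. -/
def IsProlongation (r : ℕ) (θ : SecJet n m M E r) (θ' : SubJet n m E r) : Prop :=
  ∃ (s : PointedSection n m M E) (U : Set M) (L : PointedSubmanifold n m E),
    s.IsImmersion ∧ SecJet.mk r s = θ ∧
    IsOpen U ∧ s.pt ∈ U ∧ U ⊆ s.domain ∧ L.sub.carrier = s.toFun '' U ∧ L.pt = s.val ∧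
    θ' = SubJet.mk r L

theorem exists_prolongation (r : ℕ) (θ : ImmJet n m M E r) :
    ∃ θ' : SubJet n m E r, IsProlongation r θ.1 θ' := by
  obtain ⟨s, hs, h⟩ := θ.2
  obtain ⟨U, L, h1, h2, h3, h4, h5⟩ := s.exists_image hs
  exact ⟨SubJet.mk r L, s, U, L, hs, h, h1, h2, h3, h4, h5, rfl⟩

/-- The `r`-prolongation `pr_E^{(r)} : Imm J^r pr_M → J^r(E,n)`, `[s]^r_x ↦ [im s]^r_{s(x)}`, where `im s`
is the image of a neighbourhood of `x` on which `s` is an embedding. -/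
noncomputable def prolong (r : ℕ) (θ : ImmJet n m M E r) : SubJet n m E r :=
  (exists_prolongation r θ).choose

end SectionJets

end JetSubmfd

/-!
Both horizontality conditions speak about the second covariant derivative `∇_b (dγ(a))` of a
parametrization `γ`. For a section `s` of `pr_M`, horizontality for `pr_E^*(Γ) ⊗ pr_M^*(Θ^*)` says
that it equals `ds(Θ(b, a))`, hence that it is tangent to the image of `s`. This tangency does not
depend on the coordinates of `E`, in which `∇` transforms tensorially, nor on the parametrization,
a change of which adds a tangential term. For the graph of `f` in a divided chart the part of
`∇_b (dγ(a))` transverse to the graph is exactly the vertical projection of the connection on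
`J¹(E, n)`, so the tangency is the horizontality of the prolonged jet. As a horizontal 2-jet is
determined by its 1-jet, the commutation reduces to the compatibility of prolongation with the
projections to 1-jets.
-/

namespace JetSubmfd

section Calculus

variable {V W X : Type*} [NormedAddCommGroup V] [NormedSpace ℝ V]
  [NormedAddCommGroup W] [NormedSpace ℝ W] [NormedAddCommGroup X] [NormedSpace ℝ X]

/-- The functions `f` and `g` have the same derivatives up to order `r` at `x`, i.e. the same
`r`-jet. -/
def JetEq (r : ℕ) (f g : V → W) (x : V) : Prop :=
  ∀ k ≤ r, iteratedFDeriv ℝ k f x = iteratedFDeriv ℝ k g x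

namespace JetEq

variable {r : ℕ} {f g : V → W} {x : V}

theorem fderiv_eq (h : JetEq r f g x) (hr : 1 ≤ r) : fderiv ℝ f x = fderiv ℝ g x := by
  ext v
  simpa [iteratedFDeriv_one_apply] using DFunLike.congr_fun (h 1 hr) fun _ => v

theorem fderiv_fderiv_eq (h : JetEq r f g x) (hr : 2 ≤ r) :
    fderiv ℝ (fderiv ℝ f) x = fderiv ℝ (fderiv ℝ g) x := by
  ext v w
  simpa [iteratedFDeriv_two_apply] using DFunLike.congr_fun (h 2 hr) ![v, w]

theorem of_fderiv_fderiv_eq (h₀ : f x = g x) (h₁ : fderiv ℝ f x = fderiv ℝ g x)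
    (h₂ : fderiv ℝ (fderiv ℝ f) x = fderiv ℝ (fderiv ℝ g) x) : JetEq 2 f g x := by
  intro k hk
  obtain hk | rfl := Nat.lt_or_eq_of_le hk
  · exact iteratedFDeriv_eq_of_le_one h₀ h₁ k (Nat.lt_succ_iff.1 hk)
  · ext v
    simp [iteratedFDeriv_two_apply, h₂]

end JetEq

theorem fderiv_fderiv_comp {g : W → X} {f : V → W} {x : V} (hg : ContDiffAt ℝ 2 g (f x))
    (hf : ContDiffAt ℝ 2 f x) (b a : V) :
    fderiv ℝ (fderiv ℝ (g ∘ f)) x b a =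
      fderiv ℝ (fderiv ℝ g) (f x) (fderiv ℝ f x b) (fderiv ℝ f x a) +
        fderiv ℝ g (f x) (fderiv ℝ (fderiv ℝ f) x b a) := by
  have hcomp : fderiv ℝ (g ∘ f) =ᶠ[𝓝 x] fun y => (fderiv ℝ g (f y)).comp (fderiv ℝ f y) := by
    filter_upwards [hf.eventually (by simp), hf.continuousAt.eventually (hg.eventually (by simp))]
      with y hfy hgy
    exact fderiv_comp y (hgy.differentiableAt (by simp)) (hfy.differentiableAt (by simp))
  have hDg : DifferentiableAt ℝ (fderiv ℝ g) (f x) :=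
    (hg.fderiv_right (m := 1) (by norm_num)).differentiableAt (by simp)
  have hDf : DifferentiableAt ℝ (fderiv ℝ f) x :=
    (hf.fderiv_right (m := 1) (by norm_num)).differentiableAt (by simp)
  have hDgf := hDg.hasFDerivAt.comp x (hf.differentiableAt (by simp)).hasFDerivAt
  rw [hcomp.fderiv_eq, (HasFDerivAt.clm_comp (c := fun y => fderiv ℝ g (f y)) hDgf
    hDf.hasFDerivAt).fderiv]
  simp [add_comm]

theorem fderiv_fderiv_clm_comp (ℓ : W →L[ℝ] X) {f : V → W} {x : V}
    (hf : ContDiffAt ℝ 2 f x) (b a : V) :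
    fderiv ℝ (fderiv ℝ (ℓ ∘ f)) x b a = ℓ (fderiv ℝ (fderiv ℝ f) x b a) := by
  have hDℓ : fderiv ℝ ℓ = (fun _ => ℓ) := funext fun _ => ℓ.fderiv
  simp [fderiv_fderiv_comp ℓ.contDiff.contDiffAt hf, hDℓ]

section CurvesInGraphs

variable {c : V → W × X} {f : W → X} {x : V}

theorem snd_fderiv_eq_of_eventually_mem_graph (hc : DifferentiableAt ℝ c x)
    (hf : DifferentiableAt ℝ f (c x).1) (h : ∀ᶠ y in 𝓝 x, (c y).2 = f (c y).1) (b : V) :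
    (fderiv ℝ c x b).2 = fderiv ℝ f (c x).1 (fderiv ℝ c x b).1 := by
  have hsnd : (fun y => (c y).2) =ᶠ[𝓝 x] f ∘ fun y => (c y).1 := h
  have hD := hsnd.fderiv_eq (𝕜 := ℝ)
  rw [fderiv_comp x hf hc.fst, hc.hasFDerivAt.fst.fderiv, hc.hasFDerivAt.snd.fderiv] at hD
  exact DFunLike.congr_fun hD b

theorem snd_fderiv_fderiv_eq_of_eventually_mem_graph (hc : ContDiffAt ℝ 2 c x)
    (hf : ContDiffAt ℝ 2 f (c x).1) (h : ∀ᶠ y in 𝓝 x, (c y).2 = f (c y).1) (b a : V) :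
    (fderiv ℝ (fderiv ℝ c) x b a).2 =
      fderiv ℝ (fderiv ℝ f) (c x).1 (fderiv ℝ c x b).1 (fderiv ℝ c x a).1 +
        fderiv ℝ f (c x).1 (fderiv ℝ (fderiv ℝ c) x b a).1 := by
  have hsnd : Prod.snd ∘ c =ᶠ[𝓝 x] f ∘ Prod.fst ∘ c := h
  have hfst : fderiv ℝ (Prod.fst ∘ c) x = .fst ℝ W X ∘L fderiv ℝ c x :=
    (hc.differentiableAt (by simp)).hasFDerivAt.fst.fderiv
  have hD : fderiv ℝ (fderiv ℝ (Prod.snd ∘ c)) x b a =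
      fderiv ℝ (fderiv ℝ (f ∘ Prod.fst ∘ c)) x b a := by
    rw [hsnd.fderiv.fderiv_eq]
  rw [fderiv_fderiv_comp (f := Prod.fst ∘ c) hf (contDiffAt_fst.comp x hc), hfst] at hD
  have hDfst := fderiv_fderiv_clm_comp (.fst ℝ W X) hc b a
  have hDsnd := fderiv_fderiv_clm_comp (.snd ℝ W X) hc b a
  rw [ContinuousLinearMap.coe_fst'] at hDfst
  rw [ContinuousLinearMap.coe_snd'] at hDsnd
  rwa [hDfst, hDsnd] at hD

end CurvesInGraphs

theorem exists_smooth_openPartialHomeomorph [CompleteSpace V] {f : V → W} {x : V}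
    (hf : ∀ᶠ y in 𝓝 x, ContDiffAt ℝ ∞ f y) (hi : (fderiv ℝ f x).IsInvertible) :
    ∃ Φ : OpenPartialHomeomorph V W, x ∈ Φ.source ∧ ⇑Φ = f ∧
      ContDiffOn ℝ ∞ Φ Φ.source ∧ ContDiffOn ℝ ∞ Φ.symm Φ.target := by
  obtain ⟨T, hT⟩ := hi
  have hfx := hf.self_of_nhds
  have hDf : HasFDerivAt f (T : V →L[ℝ] W) x := by
    rw [hT]
    exact (hfx.differentiableAt (by simp)).hasFDerivAt
  have hinv : ∀ᶠ y in 𝓝 x, (fderiv ℝ f y).IsInvertible :=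
    (hfx.fderiv_right (m := 0) (by norm_num)).continuousAt (hT ▸ T.nhds)
  obtain ⟨s, hs, hso, hxs⟩ := eventually_nhds_iff.1 (hf.and hinv)
  let Φ := (hfx.toOpenPartialHomeomorph f hDf (by simp)).restrOpen s hso
  refine ⟨Φ, ⟨hfx.mem_toOpenPartialHomeomorph_source hDf (by simp), hxs⟩, rfl,
    fun y hy => (hs y hy.2).1.contDiffWithinAt, fun z hz => ?_⟩
  obtain ⟨hfz, S, hS⟩ := hs _ (Φ.map_target hz).2
  refine (Φ.contDiffAt_symm (f₀' := S) hz ?_ hfz).contDiffWithinAt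
  rw [hS]
  exact (hfz.differentiableAt (by simp)).hasFDerivAt

theorem isInvertible_of_injective [FiniteDimensional ℝ V] [FiniteDimensional ℝ W]
    (hd : Module.finrank ℝ V = Module.finrank ℝ W) {A : V →L[ℝ] W}
    (hA : Function.Injective A) : A.IsInvertible :=
  ⟨(LinearEquiv.ofInjectiveOfFinrankEq (A : V →ₗ[ℝ] W) hA hd).toContinuousLinearEquiv, rfl⟩

end Calculus

section Coordinates

variable {k : ℕ} {N : Type*} [TopologicalSpace N] [ChartedSpace (Eu k) N]
  {F F' : Type*} [NormedAddCommGroup F] [NormedSpace ℝ F] [NormedAddCommGroup F']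
  [NormedSpace ℝ F']

theorem mvfderiv_eq_comp_of_eventuallyEq {e : N → F} {e' : N → F'} {τ : F → F'} {p : N}
    (he : MDifferentiableAt (𝓡 k) 𝓘(ℝ, F) e p) (hτ : DifferentiableAt ℝ τ (e p))
    (h : e' =ᶠ[𝓝 p] τ ∘ e) :
    mvfderiv (𝓡 k) e' p = fderiv ℝ τ (e p) ∘L mvfderiv (𝓡 k) e p := by
  unfold mvfderiv
  rw [h.mfderiv_eq, mfderiv_comp p hτ.mdifferentiableAt he, mfderiv_eq_fderiv]
  rfl

variable (k) in
/-- The function `e` is a system of smooth coordinates at `p`: it is smooth near `p` and its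
differential at `p` is invertible. In contrast with a chart, no domain is specified and the
coordinate space is any normed space. -/
structure IsCoordAt (e : N → F) (p : N) : Prop where
  eventually_contMDiffAt : ∀ᶠ q in 𝓝 p, ContMDiffAt (𝓡 k) 𝓘(ℝ, F) ∞ e q
  isInvertible : (mfderiv (𝓡 k) 𝓘(ℝ, F) e p).IsInvertible

namespace IsCoordAt

variable {e : N → F} {e' : N → F'} {p : N}

theorem contMDiffAt (he : IsCoordAt k e p) : ContMDiffAt (𝓡 k) 𝓘(ℝ, F) ∞ e p :=
  he.eventually_contMDiffAt.self_of_nhds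

theorem mdifferentiableAt (he : IsCoordAt k e p) : MDifferentiableAt (𝓡 k) 𝓘(ℝ, F) e p :=
  he.contMDiffAt.mdifferentiableAt (by simp)

theorem finiteDimensional (he : IsCoordAt k e p) : FiniteDimensional ℝ F := by
  obtain ⟨T : Eu k ≃L[ℝ] F, -⟩ := he.isInvertible
  exact T.toLinearEquiv.finiteDimensional

theorem of_mem_maximalAtlas {e : OpenPartialHomeomorph N (Eu k)}
    (he : e ∈ IsManifold.maximalAtlas (𝓡 k) ∞ N) (hp : p ∈ e.source) : IsCoordAt k e p where
  eventually_contMDiffAt :=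
    eventually_of_mem (e.open_source.mem_nhds hp) fun _ => contMDiffAt_of_mem_maximalAtlas he
  isInvertible := chart_mfderiv_isInvertible he hp

variable [IsManifold (𝓡 k) ∞ N]

theorem exists_openPartialHomeomorph (he : IsCoordAt k e p) :
    ∃ Φ : OpenPartialHomeomorph N F, p ∈ Φ.source ∧ EqOn Φ e Φ.source ∧
      ContMDiffOn (𝓡 k) 𝓘(ℝ, F) ∞ Φ Φ.source ∧
      ContMDiffOn 𝓘(ℝ, F) (𝓡 k) ∞ Φ.symm Φ.target := by
  set χ := chartAt (Eu k) p
  have hp : p ∈ χ.source := mem_chart_source _ p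
  have hχ : ContMDiffOn (𝓡 k) (𝓡 k) ∞ χ χ.source := contMDiffOn_chart
  have hχ' : ContMDiffOn (𝓡 k) (𝓡 k) ∞ χ.symm χ.target := contMDiffOn_chart_symm
  have hsymm : ∀ y ∈ χ.target, ContMDiffAt (𝓡 k) (𝓡 k) ∞ χ.symm y := fun y hy =>
    hχ'.contMDiffAt (χ.open_target.mem_nhds hy)
  have hf : ∀ᶠ y in 𝓝 (χ p), ContDiffAt ℝ ∞ (e ∘ χ.symm) y := by
    have hcont := χ.tendsto_symm hp
    filter_upwards [hcont.eventually he.eventually_contMDiffAt,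
      χ.open_target.mem_nhds (χ.map_source hp)] with y hey hy
    exact (hey.comp y (hsymm y hy)).contDiffAt
  have hinv : (fderiv ℝ (e ∘ χ.symm) (χ p)).IsInvertible := by
    have hd : χ.MDifferentiable (𝓡 k) (𝓡 k) :=
      ⟨hχ.mdifferentiableOn (by simp), hχ'.mdifferentiableOn (by simp)⟩
    rw [← mfderiv_eq_fderiv, mfderiv_comp_of_eq he.mdifferentiableAt
      ((hsymm _ (χ.map_source hp)).mdifferentiableAt (by simp)) (χ.left_inv hp), χ.left_inv hp]
    exact he.isInvertible.comp ⟨hd.symm.mfderiv (χ.map_source hp), rfl⟩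
  obtain ⟨Ψ, hpΨ, hΨ, hΨs, hΨt⟩ := exists_smooth_openPartialHomeomorph hf hinv
  refine ⟨χ.trans Ψ, by simp [hp, hpΨ], fun q hq => ?_, ?_, ?_⟩
  · rw [χ.trans_source] at hq
    simp [hΨ, χ.left_inv hq.1]
  · rw [χ.trans_source]
    exact hΨs.contMDiffOn.comp (hχ.mono inter_subset_left) inter_subset_right
  · rw [χ.trans_target]
    exact hχ'.comp (hΨt.contMDiffOn.mono inter_subset_left) inter_subset_right

theorem eventually (he : IsCoordAt k e p) : ∀ᶠ q in 𝓝 p, IsCoordAt k e q := by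
  obtain ⟨Φ, hp, hΦ, hs, ht⟩ := he.exists_openPartialHomeomorph
  have hd : Φ.MDifferentiable (𝓡 k) 𝓘(ℝ, F) :=
    ⟨hs.mdifferentiableOn (by simp), ht.mdifferentiableOn (by simp)⟩
  filter_upwards [he.eventually_contMDiffAt.eventually_nhds, Φ.open_source.mem_nhds hp]
    with q hq hqΦ
  refine ⟨hq, ?_⟩
  rw [← (hΦ.eventuallyEq_of_mem (Φ.open_source.mem_nhds hqΦ)).mfderiv_eq]
  exact ⟨hd.mfderiv hqΦ, rfl⟩

theorem exists_transition (he : IsCoordAt k e p)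
    (he' : ContMDiffAt (𝓡 k) 𝓘(ℝ, F') ∞ e' p) :
    ∃ τ : F → F', ContDiffAt ℝ ∞ τ (e p) ∧ e' =ᶠ[𝓝 p] τ ∘ e := by
  obtain ⟨Φ, hp, hΦ, -, ht⟩ := he.exists_openPartialHomeomorph
  refine ⟨e' ∘ Φ.symm, ?_, ?_⟩
  · rw [← hΦ hp]
    have hsymm := ht.contMDiffAt (Φ.open_target.mem_nhds (Φ.map_source hp))
    exact (he'.comp_of_eq hsymm (Φ.left_inv hp)).contDiffAt
  · filter_upwards [Φ.open_source.mem_nhds hp] with q hq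
    simp only [Function.comp_apply]
    rw [← hΦ hq, Φ.left_inv hq]

end IsCoordAt

end Coordinates

section Christoffel

variable {k : ℕ} {N : Type*} [TopologicalSpace N] [ChartedSpace (Eu k) N]
  {F F' : Type*} [NormedAddCommGroup F] [NormedSpace ℝ F] [NormedAddCommGroup F']
  [NormedSpace ℝ F']

theorem mvfderiv_coordField {e : N → F} {p : N}
    (hi : (mfderiv (𝓡 k) 𝓘(ℝ, F) e p).IsInvertible) (w : F) :
    mvfderiv (𝓡 k) e p (coordField e w p) = w :=
  hi.self_apply_inverse w

theorem coordField_mvfderiv {e : N → F} {p : N}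
    (hi : (mfderiv (𝓡 k) 𝓘(ℝ, F) e p).IsInvertible) (X : TangentSpace (𝓡 k) p) :
    coordField e (mvfderiv (𝓡 k) e p X) p = X :=
  hi.inverse_apply_self X

theorem coordField_sum_smul {e : N → F} {ι : Type*} (s : Finset ι) (c : ι → N → ℝ)
    (b : ι → F) : (fun q => coordField e (∑ i ∈ s, c i q • b i) q) =
      ∑ i ∈ s, c i • (coordField e (b i) : Π q : N, TangentSpace (𝓡 k) q) := by
  funext q
  rw [Finset.sum_apply]
  refine (map_sum (mfderiv (𝓡 k) 𝓘(ℝ, F) e q).inverse _ s).trans ?_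
  exact Finset.sum_congr rfl fun i _ => map_smul (mfderiv (𝓡 k) 𝓘(ℝ, F) e q).inverse _ _

variable [IsManifold (𝓡 k) ∞ N]

theorem coordField_eventuallyEq {e : N → F} {e' : N → F'} {τ : F → F'} {p : N}
    (he : IsCoordAt k e p) (he' : IsCoordAt k e' p) (hτ : ContDiffAt ℝ 1 τ (e p))
    (h : e' =ᶠ[𝓝 p] τ ∘ e) (w : F) :
    ∀ᶠ q in 𝓝 p, (coordField e w q : TangentSpace (𝓡 k) q) =
      coordField e' (fderiv ℝ τ (e q) w) q := by
  filter_upwards [he.eventually, he'.eventually, h.eventually_nhds,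
    he.contMDiffAt.continuousAt.eventually (hτ.eventually (by simp))] with q heq he'q hq hτq
  rw [← coordField_mvfderiv he'q.isInvertible (coordField e w q), mvfderiv_eq_comp_of_eventuallyEq
    heq.mdifferentiableAt (hτq.differentiableAt (by simp)) hq, ContinuousLinearMap.comp_apply,
    mvfderiv_coordField heq.isInvertible]

variable (Γ : TorsionFreeConnection k N)

theorem TorsionFreeConnection.cov_finset_sum {ι : Type*}
    (s : Finset ι) (g : ι → N → ℝ) (σ : ι → Π q : N, TangentSpace (𝓡 k) q) {p : N}
    (hg : ∀ i, MDifferentiableAt (𝓡 k) 𝓘(ℝ, ℝ) (g i) p)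
    (hσ : ∀ i, MDifferentiableAt (𝓡 k) ((𝓡 k).prod (𝓡 k))
      (fun q => (⟨q, σ i q⟩ : Bundle.TotalSpace (Eu k) (TangentSpace (𝓡 k)))) p)
    (X : TangentSpace (𝓡 k) p) :
    MDifferentiableAt (𝓡 k) ((𝓡 k).prod (𝓡 k))
      (fun q => (⟨q, (∑ i ∈ s, g i • σ i) q⟩ :
        Bundle.TotalSpace (Eu k) (TangentSpace (𝓡 k)))) p ∧
    Γ.cov (∑ i ∈ s, g i • σ i) p X =
      ∑ i ∈ s, (g i p • Γ.cov (σ i) p X + mvfderiv (𝓡 k) (g i) p X • σ i p) := by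
  classical
  induction s using Finset.induction_on with
  | empty =>
    simp only [Finset.sum_empty, Γ.cov.zero]
    exact ⟨Bundle.mdifferentiableAt_zeroSection .., rfl⟩
  | insert i s hi ih =>
    have hgσ := (hg i).smul_section (hσ i)
    rw [Finset.sum_insert hi, Finset.sum_insert hi]
    refine ⟨mdifferentiableAt_add_section hgσ ih.1, ?_⟩
    rw [Γ.cov.isCovariantDerivativeOnUniv.add hgσ ih.1,
      Γ.cov.isCovariantDerivativeOnUniv.leibniz (hσ i) (hg i), ← ih.2]
    rfl

theorem christoffel_sum_smul_right {e : N → F} {p : N} (he : IsCoordAt k e p) {ι : Type*}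
    (s : Finset ι) (c : ι → ℝ) (b : ι → F) (v : F) :
    christoffel Γ e p v (∑ i ∈ s, c i • b i) = ∑ i ∈ s, c i • christoffel Γ e p v (b i) := by
  let G : F →ₗ[ℝ] F :=
    { toFun := christoffel Γ e p v
      map_add' := christoffel_add_right Γ he.contMDiffAt he.isInvertible v
      map_smul' := fun c => christoffel_smul_right Γ he.contMDiffAt he.isInvertible c v }
  exact (map_sum G (fun i => c i • b i) s).trans (Finset.sum_congr rfl fun i _ => G.map_smul _ _)

theorem cov_coordField {e : N → F} {p : N} (he : IsCoordAt k e p) {g : N → F}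
    (hg : MDifferentiableAt (𝓡 k) 𝓘(ℝ, F) g p) (X : TangentSpace (𝓡 k) p) :
    MDifferentiableAt (𝓡 k) ((𝓡 k).prod (𝓡 k))
      (fun q => (⟨q, coordField e (g q) q⟩ :
        Bundle.TotalSpace (Eu k) (TangentSpace (𝓡 k)))) p ∧
    mvfderiv (𝓡 k) e p (Γ.cov (fun q => coordField e (g q) q) p X) =
      christoffel Γ e p (mvfderiv (𝓡 k) e p X) (g p) + mvfderiv (𝓡 k) g p X := by
  have := he.finiteDimensional
  let b := Module.finBasis ℝ F
  let ℓ := fun i => LinearMap.toContinuousLinearMap (b.coord i)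
  have hb : ∀ y, ∑ i, ℓ i y • b i = y := b.sum_repr
  have hsum := coordField_sum_smul (k := k) (e := e) Finset.univ (fun i q => ℓ i (g q)) b
  simp only [hb] at hsum
  obtain ⟨hd, hcov⟩ := Γ.cov_finset_sum Finset.univ (fun i q => ℓ i (g q))
    (fun i => coordField e (b i))
    (fun i => (ℓ i).differentiableAt.mdifferentiableAt.comp p hg)
    (fun i => mdiff_coordField he.contMDiffAt he.isInvertible (b i)) X
  rw [← hsum] at hd hcov
  have hDg : ∀ i, mvfderiv (𝓡 k) (fun q => ℓ i (g q)) p X = ℓ i (mvfderiv (𝓡 k) g p X) := by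
    intro i
    rw [mvfderiv_eq_comp_of_eventuallyEq (e' := fun q => ℓ i (g q)) hg (ℓ i).differentiableAt .rfl,
      (ℓ i).fderiv]
    rfl
  have hΓ : ∀ i, mvfderiv (𝓡 k) e p (Γ.cov (coordField e (b i)) p X) =
      christoffel Γ e p (mvfderiv (𝓡 k) e p X) (b i) := by
    intro i
    rw [christoffel, coordField_mvfderiv he.isInvertible]
    rfl
  refine ⟨hd, ?_⟩
  simp only [hcov, map_sum, map_add, map_smul, hDg, hΓ, mvfderiv_coordField he.isInvertible,
    Finset.sum_add_distrib, hb, ← christoffel_sum_smul_right Γ he]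

theorem christoffel_transition {e : N → F} {e' : N → F'} {τ : F → F'} {p : N}
    (he : IsCoordAt k e p) (he' : IsCoordAt k e' p) (hτ : ContDiffAt ℝ 2 τ (e p))
    (h : e' =ᶠ[𝓝 p] τ ∘ e) (v w : F) :
    fderiv ℝ τ (e p) (christoffel Γ e p v w) =
      christoffel Γ e' p (fderiv ℝ τ (e p) v) (fderiv ℝ τ (e p) w) +
        fderiv ℝ (fderiv ℝ τ) (e p) v w := by
  have hτd : DifferentiableAt ℝ τ (e p) := hτ.differentiableAt (by simp)
  have hDτ : DifferentiableAt ℝ (fderiv ℝ τ) (e p) :=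
    (hτ.fderiv_right (m := 1) (by norm_num)).differentiableAt (by simp)
  have hDτw : HasFDerivAt (fun y => fderiv ℝ τ y w)
      ((fderiv ℝ (fderiv ℝ τ) (e p)).flip w) (e p) := by
    simpa using hDτ.hasFDerivAt.clm_apply (hasFDerivAt_const w (e p))
  set X : TangentSpace (𝓡 k) p := coordField e v p
  have heX : mvfderiv (𝓡 k) e p X = v := mvfderiv_coordField he.isInvertible v
  have hDe' := mvfderiv_eq_comp_of_eventuallyEq he.mdifferentiableAt hτd h
  have hDe'X : mvfderiv (𝓡 k) e' p X = fderiv ℝ τ (e p) v := by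
    rw [hDe', ContinuousLinearMap.comp_apply, heX]
  have hDg : mvfderiv (𝓡 k) (fun q => fderiv ℝ τ (e q) w) p X =
      fderiv ℝ (fderiv ℝ τ) (e p) v w := by
    rw [mvfderiv_eq_comp_of_eventuallyEq (e' := fun q => fderiv ℝ τ (e q) w) he.mdifferentiableAt
      hDτw.differentiableAt .rfl, hDτw.fderiv, ContinuousLinearMap.comp_apply, heX,
      ContinuousLinearMap.flip_apply]
  obtain ⟨hd, hcov⟩ := cov_coordField Γ he' (g := fun q => fderiv ℝ τ (e q) w)
    (hDτw.differentiableAt.mdifferentiableAt.comp p he.mdifferentiableAt) X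
  have hcongr := Γ.cov.isCovariantDerivativeOnUniv.congr_of_eventuallyEq
    (mdiff_coordField he.contMDiffAt he.isInvertible w) hd univ_mem
    (coordField_eventuallyEq he he' (hτ.of_le (by norm_num)) h w)
  rw [← hDe'X, ← hDg, ← hcov, ← hcongr, hDe']
  rfl

end Christoffel

section CovHessian

variable {k : ℕ} {N : Type*} [TopologicalSpace N] [ChartedSpace (Eu k) N]
  {F F' V : Type*} [NormedAddCommGroup F] [NormedSpace ℝ F] [NormedAddCommGroup F']
  [NormedSpace ℝ F'] [NormedAddCommGroup V] [NormedSpace ℝ V]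
  {e : N → F} {e' : N → F'} {γ : V → N} {x : V}

theorem fderiv_coord_comp (he : MDifferentiableAt (𝓡 k) 𝓘(ℝ, F) e (γ x))
    (hγ : MDifferentiableAt 𝓘(ℝ, V) (𝓡 k) γ x) (b : V) :
    fderiv ℝ (e ∘ γ) x b = mvfderiv (𝓡 k) e (γ x) (mfderiv 𝓘(ℝ, V) (𝓡 k) γ x b) := by
  rw [← mfderiv_eq_fderiv, mfderiv_comp x he hγ]
  rfl

theorem contDiffAt_coord_comp {r : WithTop ℕ∞} (hr : r ≤ ∞) (he : IsCoordAt k e (γ x))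
    (hγ : ContMDiffAt 𝓘(ℝ, V) (𝓡 k) r γ x) : ContDiffAt ℝ r (e ∘ γ) x :=
  ((he.contMDiffAt.of_le hr).comp x hγ).contDiffAt

theorem fderiv_coord_comp_of_eventuallyEq {τ : F → F'} (hτ : DifferentiableAt ℝ τ (e (γ x)))
    (h : e' =ᶠ[𝓝 (γ x)] τ ∘ e) (hγ : ContinuousAt γ x) (heγ : DifferentiableAt ℝ (e ∘ γ) x) :
    fderiv ℝ (e' ∘ γ) x = fderiv ℝ τ (e (γ x)) ∘L fderiv ℝ (e ∘ γ) x := by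
  have hcomp : e' ∘ γ =ᶠ[𝓝 x] τ ∘ e ∘ γ := hγ.eventually h
  rw [hcomp.fderiv_eq, fderiv_comp x hτ heγ]
  rfl

variable (k) in
/-- The map `γ` parametrizes the set `L` near `γ x`, in the sense that it is an immersion at `x` and
takes its values in `L` near `x`. -/
structure IsParamAt (L : Set N) (γ : V → N) (x : V) : Prop where
  contMDiffAt : ContMDiffAt 𝓘(ℝ, V) (𝓡 k) ∞ γ x
  eventually_mem : ∀ᶠ y in 𝓝 x, γ y ∈ L
  injective : Function.Injective (mfderiv 𝓘(ℝ, V) (𝓡 k) γ x)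

variable [IsManifold (𝓡 k) ∞ N] (Γ : TorsionFreeConnection k N)

/-- The second covariant derivative `∇_b (dγ(a))` at `x` of a map `γ` from a vector space to `N`,
in the coordinates `e`. -/
noncomputable def covHessian (e : N → F) (γ : V → N) (x b a : V) : F :=
  fderiv ℝ (fderiv ℝ (e ∘ γ)) x b a +
    christoffel Γ e (γ x) (fderiv ℝ (e ∘ γ) x b) (fderiv ℝ (e ∘ γ) x a)

theorem covHessian_transition {τ : F → F'} (he : IsCoordAt k e (γ x))
    (he' : IsCoordAt k e' (γ x)) (hτ : ContDiffAt ℝ 2 τ (e (γ x)))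
    (h : e' =ᶠ[𝓝 (γ x)] τ ∘ e) (hγ : ContMDiffAt 𝓘(ℝ, V) (𝓡 k) 2 γ x) (b a : V) :
    covHessian Γ e' γ x b a = fderiv ℝ τ (e (γ x)) (covHessian Γ e γ x b a) := by
  have heγ : ContDiffAt ℝ 2 (e ∘ γ) x := contDiffAt_coord_comp two_le_infty he hγ
  have he'γ : e' ∘ γ =ᶠ[𝓝 x] τ ∘ e ∘ γ := hγ.continuousAt.eventually h
  unfold covHessian
  rw [map_add, christoffel_transition Γ he he' hτ h,
    fderiv_coord_comp_of_eventuallyEq (hτ.differentiableAt (by simp)) h hγ.continuousAt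
      (heγ.differentiableAt (by simp)),
    he'γ.fderiv.fderiv_eq, fderiv_fderiv_comp (f := e ∘ γ) hτ heγ]
  simp only [Function.comp_apply, ContinuousLinearMap.comp_apply]
  abel

theorem covHessian_mem_range_of_mem_range (he : IsCoordAt k e (γ x)) (he' : IsCoordAt k e' (γ x))
    (hγ : ContMDiffAt 𝓘(ℝ, V) (𝓡 k) 2 γ x) {b a : V}
    (h : covHessian Γ e γ x b a ∈ range (fderiv ℝ (e ∘ γ) x)) :
    covHessian Γ e' γ x b a ∈ range (fderiv ℝ (e' ∘ γ) x) := by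
  obtain ⟨τ, hτ, hτe⟩ := he.exists_transition he'.contMDiffAt
  have heγ : ContDiffAt ℝ 2 (e ∘ γ) x := contDiffAt_coord_comp two_le_infty he hγ
  obtain ⟨v, hv⟩ := h
  refine ⟨v, ?_⟩
  rw [covHessian_transition Γ he he' (hτ.of_le two_le_infty) hτe hγ, ← hv,
    fderiv_coord_comp_of_eventuallyEq (hτ.differentiableAt (by simp)) hτe hγ.continuousAt
      (heγ.differentiableAt (by simp))]
  rfl

theorem covHessian_mem_range_iff (he : IsCoordAt k e (γ x)) (he' : IsCoordAt k e' (γ x))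
    (hγ : ContMDiffAt 𝓘(ℝ, V) (𝓡 k) 2 γ x) (b a : V) :
    covHessian Γ e γ x b a ∈ range (fderiv ℝ (e ∘ γ) x) ↔
      covHessian Γ e' γ x b a ∈ range (fderiv ℝ (e' ∘ γ) x) :=
  ⟨covHessian_mem_range_of_mem_range Γ he he' hγ, covHessian_mem_range_of_mem_range Γ he' he hγ⟩

end CovHessian

section TangentPlane

variable {n m : ℕ} {E : Type*} [TopologicalSpace E] [ChartedSpace (Eu (n + m)) E]

theorem vertProj_add (P : Eu n →L[ℝ] Eu m) (y z : Eu n × Eu m) :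
    vertProj P (y + z) = vertProj P y + vertProj P z := by
  simp only [vertProj, Prod.snd_add, Prod.fst_add, map_add]
  abel

theorem vertProj_eq_zero_iff {P : Eu n →L[ℝ] Eu m} {y : Eu n × Eu m} :
    vertProj P y = 0 ↔ y = horLift P y.1 := by
  simp [vertProj, horLift, sub_eq_zero, Prod.ext_iff]

/-- The tangent plane at `p` of the submanifold which is the graph of `f` in the divided chart `u`.
It is a set of elements of the model space `ℝⁿ⁺ᵐ`, to which every tangent space of `E` is
definitionally equal, so that tangent planes at equal points can be compared. -/
def DividedChart.tangentPlane (u : DividedChart n m E) (f : Eu n → Eu m) (p : E) :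
    Set (Eu (n + m)) :=
  {X | vertProj (fderiv ℝ f (u.coord p).1) (mvfderiv (𝓡 (n + m)) u.coord p X) = 0}

theorem DividedChart.IsGraphAt.snd_eq {u : DividedChart n m E} {L : Set E} {p : E}
    {f : Eu n → Eu m} (hu : u.IsGraphAt L p f) (hp : p ∈ L) :
    (u.coord p).2 = f (u.coord p).1 := hu.2.2.self_of_nhds.1 hp

/-- The parametrization `x ↦ (x, f x)` of a graph in the divided chart `u`. -/
def DividedChart.graphParam (u : DividedChart n m E) (f : Eu n → Eu m) (x : Eu n) : E :=
  u.chart.symm (u.split.symm (x, f x))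

theorem DividedChart.IsGraphAt.graphParam_eq {u : DividedChart n m E} {L : Set E} {p : E}
    {f : Eu n → Eu m} (hu : u.IsGraphAt L p f) (hp : p ∈ L) :
    u.graphParam f (u.coord p).1 = p := by
  rw [graphParam, ← hu.snd_eq hp]
  simp [DividedChart.coord, hu.1]

namespace IsParamAt

variable {L : Set E} {γ : Eu n → E} {x : Eu n} {u : DividedChart n m E} {f : Eu n → Eu m}

theorem contDiffAt_comp {F : Type*} [NormedAddCommGroup F] [NormedSpace ℝ F] {e : E → F}
    (hγ : IsParamAt (n + m) L γ x) (he : IsCoordAt (n + m) e (γ x)) : ContDiffAt ℝ ∞ (e ∘ γ) x :=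
  contDiffAt_coord_comp le_rfl he hγ.contMDiffAt

theorem injective_fderiv {F : Type*} [NormedAddCommGroup F] [NormedSpace ℝ F] {e : E → F}
    (hγ : IsParamAt (n + m) L γ x) (he : IsCoordAt (n + m) e (γ x)) :
    Function.Injective (fderiv ℝ (e ∘ γ) x) := fun b b' h => by
  have hγd := hγ.contMDiffAt.mdifferentiableAt (by simp)
  rw [fderiv_coord_comp he.mdifferentiableAt hγd, fderiv_coord_comp he.mdifferentiableAt hγd] at h
  exact hγ.injective (he.isInvertible.injective h)

theorem eventually_snd_eq (hγ : IsParamAt (n + m) L γ x) (hu : u.IsGraphAt L (γ x) f) :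
    ∀ᶠ y in 𝓝 x, (u.coord (γ y)).2 = f (u.coord (γ y)).1 := by
  filter_upwards [hγ.contMDiffAt.continuousAt.eventually hu.2.2, hγ.eventually_mem] with y hy hyL
  exact hy.1 hyL

end IsParamAt

variable [IsManifold (𝓡 (n + m)) ∞ E]

theorem DividedChart.isCoordAt (u : DividedChart n m E) {p : E} (hp : p ∈ u.chart.source) :
    IsCoordAt (n + m) u.coord p where
  eventually_contMDiffAt :=
    eventually_of_mem (u.chart.open_source.mem_nhds hp) fun _ => u.contMDiffAt
  isInvertible := u.isInvertible hp

theorem DividedChart.IsGraphAt.isParamAt {u : DividedChart n m E} {L : Set E} {p : E}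
    {f : Eu n → Eu m} (hu : u.IsGraphAt L p f) (hp : p ∈ L) :
    IsParamAt (n + m) L (u.graphParam f) (u.coord p).1 := by
  set x := (u.coord p).1 with hx
  have hbase : u.graphParam f x = p := hu.graphParam_eq hp
  have hxf : u.split.symm (x, f x) = u.chart p := by
    rw [hx, ← hu.snd_eq hp]
    exact u.split.symm_apply_apply _
  have hxtarget : u.split.symm (x, f x) ∈ u.chart.target := hxf ▸ u.chart.map_source hu.1
  have hf : ContDiffAt ℝ ∞ f x := hu.2.1.self_of_nhds
  have hgraph : ContDiffAt ℝ ∞ (fun y => u.split.symm (y, f y)) x :=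
    u.split.symm.contDiff.contDiffAt.comp x (contDiffAt_id.prodMk hf)
  have htarget : ∀ᶠ y in 𝓝 x, u.split.symm (y, f y) ∈ u.chart.target :=
    hgraph.continuousAt.eventually (u.chart.open_target.mem_nhds hxtarget)
  have hcoord : ∀ᶠ y in 𝓝 x, u.coord (u.graphParam f y) = (y, f y) := htarget.mono fun y hy => by
    simp [DividedChart.coord, DividedChart.graphParam, u.chart.right_inv hy]
  have hsmooth : ContMDiffAt 𝓘(ℝ, Eu n) (𝓡 (n + m)) ∞ (u.graphParam f) x :=
    ((contMDiffOn_symm_of_mem_maximalAtlas u.chart_mem).contMDiffAt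
      (u.chart.open_target.mem_nhds hxtarget)).comp x hgraph.contMDiffAt
  refine ⟨hsmooth, ?_, fun b b' hbb' => ?_⟩
  · have hL := hsmooth.continuousAt.eventually (hbase.symm ▸ hu.2.2)
    filter_upwards [hL, hcoord] with y hyL hy
    rw [hyL, hy]
  · have hD : HasFDerivAt (u.coord ∘ u.graphParam f) ((ContinuousLinearMap.id ℝ (Eu n)).prod
        (fderiv ℝ f x)) x :=
      ((hasFDerivAt_id x).prodMk (hf.differentiableAt (by simp)).hasFDerivAt).congr_of_eventuallyEq
        hcoord
    have hDe := fun b => fderiv_coord_comp (hbase.symm ▸ (u.isCoordAt hu.1).mdifferentiableAt)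
      (hsmooth.mdifferentiableAt (by simp)) b
    have hgraphD := (hDe b).trans ((congrArg _ hbb').trans (hDe b').symm)
    rw [hD.fderiv] at hgraphD
    exact congrArg Prod.fst hgraphD

namespace IsParamAt

variable {L : Set E} {γ : Eu n → E} {x : Eu n} {u : DividedChart n m E} {f : Eu n → Eu m}

theorem fderiv_eq_horLift (hγ : IsParamAt (n + m) L γ x) (hu : u.IsGraphAt L (γ x) f) (b : Eu n) :
    fderiv ℝ (u.coord ∘ γ) x b =
      horLift (fderiv ℝ f (u.coord (γ x)).1) (fderiv ℝ (u.coord ∘ γ) x b).1 :=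
  Prod.ext rfl <| snd_fderiv_eq_of_eventually_mem_graph (c := u.coord ∘ γ)
    ((hγ.contDiffAt_comp (u.isCoordAt hu.1)).differentiableAt (by simp))
    (hu.2.1.self_of_nhds.differentiableAt (by simp)) (hγ.eventually_snd_eq hu) b

theorem surjective_fst_fderiv (hγ : IsParamAt (n + m) L γ x) (hu : u.IsGraphAt L (γ x) f) :
    Function.Surjective fun b => (fderiv ℝ (u.coord ∘ γ) x b).1 := by
  refine LinearMap.surjective_of_injective
    (f := (LinearMap.fst ℝ _ _).comp (fderiv ℝ (u.coord ∘ γ) x : Eu n →ₗ[ℝ] Eu n × Eu m))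
    fun b b' h => hγ.injective_fderiv (u.isCoordAt hu.1) ?_
  rw [hγ.fderiv_eq_horLift hu b, hγ.fderiv_eq_horLift hu b']
  exact congrArg _ h

theorem mem_range_fderiv_iff (hγ : IsParamAt (n + m) L γ x) (hu : u.IsGraphAt L (γ x) f)
    {y : Eu n × Eu m} : y ∈ range (fderiv ℝ (u.coord ∘ γ) x) ↔
      vertProj (fderiv ℝ f (u.coord (γ x)).1) y = 0 := by
  rw [vertProj_eq_zero_iff]
  constructor
  · rintro ⟨b, rfl⟩
    exact hγ.fderiv_eq_horLift hu b
  · intro hy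
    obtain ⟨b, hb : _ = y.1⟩ := hγ.surjective_fst_fderiv hu y.1
    exact ⟨b, by rw [hy, ← hb]; exact hγ.fderiv_eq_horLift hu b⟩

theorem range_mfderiv_eq_tangentPlane (hγ : IsParamAt (n + m) L γ x)
    (hu : u.IsGraphAt L (γ x) f) :
    range (mfderiv 𝓘(ℝ, Eu n) (𝓡 (n + m)) γ x) = u.tangentPlane f (γ x) := by
  have he := u.isCoordAt hu.1
  ext X
  refine Iff.trans (exists_congr fun b => ?_) (hγ.mem_range_fderiv_iff hu)
  refine he.isInvertible.injective.eq_iff.symm.trans (Eq.congr_left ?_)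
  exact (fderiv_coord_comp he.mdifferentiableAt (hγ.contMDiffAt.mdifferentiableAt (by simp)) b).symm

variable (Γ : TorsionFreeConnection (n + m) E)

theorem vertProj_covHessian (hγ : IsParamAt (n + m) L γ x) (hu : u.IsGraphAt L (γ x) f)
    (b a : Eu n) :
    vertProj (fderiv ℝ f (u.coord (γ x)).1) (covHessian Γ u.coord γ x b a) =
      dotVertical Γ u (γ x) (fderiv ℝ f (u.coord (γ x)).1)
        (horLift (fderiv ℝ f (u.coord (γ x)).1) (fderiv ℝ (u.coord ∘ γ) x b).1)
        (fderiv ℝ (fderiv ℝ f) (u.coord (γ x)).1 (fderiv ℝ (u.coord ∘ γ) x b).1)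
        (fderiv ℝ (u.coord ∘ γ) x a).1 := by
  have hD := snd_fderiv_fderiv_eq_of_eventually_mem_graph (c := u.coord ∘ γ)
    ((hγ.contDiffAt_comp (u.isCoordAt hu.1)).of_le two_le_infty)
    (hu.2.1.self_of_nhds.of_le two_le_infty) (hγ.eventually_snd_eq hu) b a
  rw [covHessian, dotVertical, vertProj_add, vertProj_add, ← hγ.fderiv_eq_horLift hu,
    ← hγ.fderiv_eq_horLift hu]
  congr 1
  simp [vertProj, hD]

theorem dotVertical_eq_zero_iff {F : Type*} [NormedAddCommGroup F] [NormedSpace ℝ F] {e : E → F}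
    (hγ : IsParamAt (n + m) L γ x) (hu : u.IsGraphAt L (γ x) f)
    (he : IsCoordAt (n + m) e (γ x)) :
    (∀ b a, dotVertical Γ u (γ x) (fderiv ℝ f (u.coord (γ x)).1)
      (horLift (fderiv ℝ f (u.coord (γ x)).1) b)
      (fderiv ℝ (fderiv ℝ f) (u.coord (γ x)).1 b) a = 0) ↔
    ∀ b a, covHessian Γ e γ x b a ∈ range (fderiv ℝ (e ∘ γ) x) := by
  have hsurj := hγ.surjective_fst_fderiv hu
  rw [hsurj.forall]
  refine forall_congr' fun b => ?_
  rw [hsurj.forall]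
  refine forall_congr' fun a => ?_
  rw [← hγ.vertProj_covHessian Γ hu, ← hγ.mem_range_fderiv_iff hu]
  exact covHessian_mem_range_iff Γ (u.isCoordAt hu.1) he (hγ.contMDiffAt.of_le two_le_infty) b a

end IsParamAt

end TangentPlane

theorem IsCoordAt.of_injective {k : ℕ} {N F : Type*} [TopologicalSpace N] [ChartedSpace (Eu k) N]
    [NormedAddCommGroup F] [NormedSpace ℝ F] [FiniteDimensional ℝ F]
    (hF : Module.finrank ℝ F = k) {e : N → F} {p : N}
    (he : ∀ᶠ q in 𝓝 p, ContMDiffAt (𝓡 k) 𝓘(ℝ, F) ∞ e q)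
    (hinj : Function.Injective (mvfderiv (𝓡 k) e p)) : IsCoordAt k e p where
  eventually_contMDiffAt := he
  isInvertible := isInvertible_of_injective (V := Eu k) (W := F) (by simp [hF]) hinj

section GraphCharts

variable {n m : ℕ} {E : Type*} [TopologicalSpace E] [ChartedSpace (Eu (n + m)) E]

/-- The defining function of the graph of `f` in the divided chart `u`; the graph is its zero
set. -/
def DividedChart.definingFun (u : DividedChart n m E) (f : Eu n → Eu m) (q : E) : Eu m :=
  (u.coord q).2 - f (u.coord q).1

theorem hasFDerivAt_snd_sub_comp_fst {f : Eu n → Eu m} {y : Eu n × Eu m}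
    (hf : DifferentiableAt ℝ f y.1) :
    HasFDerivAt (fun z : Eu n × Eu m => z.2 - f z.1)
      (.snd ℝ (Eu n) (Eu m) - fderiv ℝ f y.1 ∘L .fst ℝ (Eu n) (Eu m)) y :=
  hasFDerivAt_snd.sub (hf.hasFDerivAt.comp y hasFDerivAt_fst)

variable [IsManifold (𝓡 (n + m)) ∞ E]

theorem DividedChart.mvfderiv_definingFun {u : DividedChart n m E} {f : Eu n → Eu m} {p : E}
    (hp : p ∈ u.chart.source) (hf : DifferentiableAt ℝ f (u.coord p).1)
    (X : TangentSpace (𝓡 (n + m)) p) :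
    mvfderiv (𝓡 (n + m)) (u.definingFun f) p X =
      vertProj (fderiv ℝ f (u.coord p).1) (mvfderiv (𝓡 (n + m)) u.coord p X) := by
  have hD := hasFDerivAt_snd_sub_comp_fst hf
  rw [mvfderiv_eq_comp_of_eventuallyEq (e' := u.definingFun f)
    (u.isCoordAt hp).mdifferentiableAt hD.differentiableAt .rfl, hD.fderiv]
  rfl

theorem DividedChart.isCoordAt_prodMk_definingFun {u v : DividedChart n m E} {g : Eu n → Eu m}
    {p : E} (hpu : p ∈ u.chart.source) (hpv : p ∈ v.chart.source)
    (hg : ∀ᶠ x in 𝓝 (v.coord p).1, ContDiffAt ℝ ∞ g x)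
    (htransverse : ∀ X ∈ v.tangentPlane g p, (mvfderiv (𝓡 (n + m)) u.coord p X).1 = 0 → X = 0) :
    IsCoordAt (n + m) (fun q => ((u.coord q).1, v.definingFun g q)) p := by
  have hu := u.isCoordAt hpu
  have hv := v.isCoordAt hpv
  have hsmooth : ∀ᶠ q in 𝓝 p, ContMDiffAt (𝓡 (n + m)) 𝓘(ℝ, Eu n × Eu m) ∞
      (fun q => ((u.coord q).1, v.definingFun g q)) q := by
    have hfst : Tendsto (fun q => (v.coord q).1) (𝓝 p) (𝓝 (v.coord p).1) :=
      (continuous_fst.tendsto _).comp hv.contMDiffAt.continuousAt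
    filter_upwards [hu.eventually_contMDiffAt, hv.eventually_contMDiffAt, hfst.eventually hg]
      with q huq hvq hgq
    have hdef : ContDiffAt ℝ ∞ (fun z : Eu n × Eu m => z.2 - g z.1) (v.coord q) :=
      contDiffAt_snd.sub (hgq.comp _ contDiffAt_fst)
    exact (contDiff_fst.contDiffAt.contMDiffAt.comp q huq).prodMk_space
      (hdef.contMDiffAt.comp q hvq)
  refine .of_injective (by simp) hsmooth ((injective_iff_map_eq_zero _).2 fun X hX => ?_)
  have hd := hsmooth.self_of_nhds.mdifferentiableAt (by simp)
  have hfst : mvfderiv (𝓡 (n + m)) (fun q => (u.coord q).1) p X = 0 := by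
    rw [mvfderiv_eq_comp_of_eventuallyEq (e' := fun q => (u.coord q).1) hd
      differentiableAt_fst .rfl, ContinuousLinearMap.comp_apply, hX, map_zero]
  have hsnd : mvfderiv (𝓡 (n + m)) (v.definingFun g) p X = 0 := by
    rw [mvfderiv_eq_comp_of_eventuallyEq (e' := v.definingFun g) hd
      differentiableAt_snd .rfl, ContinuousLinearMap.comp_apply, hX, map_zero]
  rw [v.mvfderiv_definingFun hpv (hg.self_of_nhds.differentiableAt (by simp))] at hsnd
  rw [mvfderiv_eq_comp_of_eventuallyEq (e' := fun q => (u.coord q).1) hu.mdifferentiableAt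
    differentiableAt_fst .rfl, fderiv_fst] at hfst
  exact htransverse X hsnd hfst

theorem DividedChart.IsGraphAt.exists_isGraphAt {u v : DividedChart n m E} {L : Set E} {p : E}
    {g : Eu n → Eu m} (hv : v.IsGraphAt L p g) (hpL : p ∈ L) (hpu : p ∈ u.chart.source)
    (htransverse : ∀ X ∈ v.tangentPlane g p, (mvfderiv (𝓡 (n + m)) u.coord p X).1 = 0 → X = 0) :
    ∃ f, u.IsGraphAt L p f := by
  obtain ⟨Φ, hpΦ, hΦ, -, hΦt⟩ :=
    (isCoordAt_prodMk_definingFun hpu hv.1 hv.2.1 htransverse).exists_openPartialHomeomorph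
  set x₀ := (u.coord p).1
  have hΦp : Φ p = (x₀, 0) := (hΦ hpΦ).trans (Prod.ext rfl (sub_eq_zero.2 (hv.snd_eq hpL)))
  have hx₀ : (x₀, (0 : Eu m)) ∈ Φ.target := hΦp ▸ Φ.map_source hpΦ
  have hσ : Tendsto (fun x => Φ.symm (x, 0)) (𝓝 x₀) (𝓝 p) := by
    have hsymm := Φ.tendsto_symm hpΦ
    rw [hΦp] at hsymm
    exact hsymm.comp ((Continuous.prodMk_left 0).tendsto x₀)
  have htarget : ∀ᶠ x in 𝓝 x₀, (x, (0 : Eu m)) ∈ Φ.target :=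
    (Continuous.prodMk_left 0).tendsto x₀ (Φ.open_target.mem_nhds hx₀)
  have hσu := hσ.eventually (u.chart.open_source.mem_nhds hpu)
  have hfst : Tendsto (fun q => (u.coord q).1) (𝓝 p) (𝓝 x₀) :=
    (continuous_fst.tendsto _).comp (u.contMDiffAt hpu).continuousAt
  refine ⟨fun x => (u.coord (Φ.symm (x, 0))).2, hpu, ?_, ?_⟩
  · filter_upwards [htarget, hσu] with x hx hxu
    have hΦx := (hΦt.contMDiffAt (Φ.open_target.mem_nhds hx)).comp x
      (contDiffAt_id.prodMk contDiffAt_const).contMDiffAt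
    exact (contDiff_snd.contDiffAt.contMDiffAt.comp x
      ((u.contMDiffAt hxu).comp x hΦx)).contDiffAt
  · filter_upwards [hv.2.2, Φ.open_source.mem_nhds hpΦ, u.chart.open_source.mem_nhds hpu,
      hfst.eventually htarget, hfst.eventually hσu] with q hqL hqΦ hqu hqt hσq
    have hproj : (u.coord (Φ.symm ((u.coord q).1, 0))).1 = (u.coord q).1 := by
      have hright := Φ.right_inv hqt
      rw [hΦ (Φ.map_target hqt)] at hright
      exact (Prod.ext_iff.1 hright).1
    have hinj : (u.coord q).2 = (u.coord (Φ.symm ((u.coord q).1, 0))).2 ↔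
        q = Φ.symm ((u.coord q).1, 0) :=
      ⟨fun h => u.chart.injOn hqu hσq (u.split.injective (Prod.ext hproj.symm h)),
        fun h => congrArg (fun q => (u.coord q).2) h⟩
    have hdef : (q = Φ.symm ((u.coord q).1, 0)) ↔ v.definingFun g q = 0 := by
      rw [Φ.eq_symm_apply hqΦ hqt, hΦ hqΦ, Prod.mk_right_inj]
    rw [hqL, hinj, hdef, DividedChart.definingFun, sub_eq_zero]

theorem DividedChart.IsGraphAt.tangentPlane_eq {u v : DividedChart n m E} {L : Set E} {p : E}
    {f g : Eu n → Eu m} (hu : u.IsGraphAt L p f) (hv : v.IsGraphAt L p g) (hp : p ∈ L) :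
    u.tangentPlane f p = v.tangentPlane g p := by
  have hγ := hu.isParamAt hp
  have hbase := hu.graphParam_eq hp
  rw [← hbase] at hu hv
  have h := (hγ.range_mfderiv_eq_tangentPlane hu).symm.trans (hγ.range_mfderiv_eq_tangentPlane hv)
  rwa [hbase] at h

theorem DividedChart.eq_zero_of_mem_tangentPlane {u : DividedChart n m E} {f : Eu n → Eu m} {p : E}
    (hp : p ∈ u.chart.source) {X : Eu (n + m)} (hX : X ∈ u.tangentPlane f p)
    (hX₁ : (mvfderiv (𝓡 (n + m)) u.coord p X).1 = 0) : X = 0 := by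
  refine (injective_iff_map_eq_zero (mvfderiv (𝓡 (n + m)) u.coord p)).1
    (u.isInvertible hp).injective X ?_
  rw [vertProj_eq_zero_iff.1 hX, hX₁]
  simp [horLift]

theorem DividedChart.fderiv_eq_of_tangentPlane_eq {u : DividedChart n m E} {f g : Eu n → Eu m}
    {p : E} (hp : p ∈ u.chart.source) (h : u.tangentPlane f p = u.tangentPlane g p) :
    fderiv ℝ f (u.coord p).1 = fderiv ℝ g (u.coord p).1 := by
  ext1 b
  obtain ⟨X, hX⟩ := (u.isInvertible hp).surjective (horLift (fderiv ℝ f (u.coord p).1) b)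
  have hXf : X ∈ u.tangentPlane f p :=
    vertProj_eq_zero_iff.2 (hX.trans (congrArg _ (congrArg Prod.fst hX).symm))
  have hXg := vertProj_eq_zero_iff.1 (h ▸ hXf : X ∈ u.tangentPlane g p)
  exact congrArg Prod.snd (hX.symm.trans (hXg.trans (congrArg _ (congrArg Prod.fst hX))))

end GraphCharts

section Contact

variable {n m : ℕ} {E : Type*} [TopologicalSpace E] [ChartedSpace (Eu (n + m)) E]
  {P P' : PointedSubmanifold n m E}

theorem HasContact.symm {r : ℕ} (h : HasContact r P P') : HasContact r P' P := by
  obtain ⟨hp, u, f, f', hf, hf', hjet⟩ := h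
  rw [hp] at hf hf' hjet
  exact ⟨hp.symm, u, f', f, hf', hf, fun k hk => (hjet k hk).symm⟩

theorem SubJet.pt_eq_of_mk_eq {r : ℕ} (h : SubJet.mk r P = SubJet.mk r P') : P.pt = P'.pt :=
  congrArg (Quot.lift PointedSubmanifold.pt fun _ _ h => h.1) h

variable [IsManifold (𝓡 (n + m)) ∞ E]

/-- The tangent plane `T_p L` of a pointed submanifold, computed in an arbitrary divided chart
concordant to it. -/
noncomputable def PointedSubmanifold.tangentPlane (P : PointedSubmanifold n m E) :
    Set (Eu (n + m)) :=
  let u := (P.sub.exists_isGraphAt P.pt P.pt_mem).choose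
  u.tangentPlane (P.sub.exists_isGraphAt P.pt P.pt_mem).choose_spec.choose P.pt

theorem PointedSubmanifold.tangentPlane_eq {u : DividedChart n m E} {f : Eu n → Eu m}
    (hu : u.IsGraphAt P.sub.carrier P.pt f) : P.tangentPlane = u.tangentPlane f P.pt :=
  (P.sub.exists_isGraphAt P.pt P.pt_mem).choose_spec.choose_spec.tangentPlane_eq hu P.pt_mem

theorem HasContact.tangentPlane_eq {r : ℕ} (hr : 1 ≤ r) (h : HasContact r P P') :
    P.tangentPlane = P'.tangentPlane := by
  obtain ⟨hp, u, f, f', hf, hf', hjet⟩ := h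
  rw [PointedSubmanifold.tangentPlane_eq hf, PointedSubmanifold.tangentPlane_eq (hp ▸ hf'),
    DividedChart.tangentPlane, DividedChart.tangentPlane, JetEq.fderiv_eq hjet hr, hp]

theorem SubJet.tangentPlane_eq_of_mk_eq {r : ℕ} (hr : 1 ≤ r)
    (h : SubJet.mk r P = SubJet.mk r P') : P.tangentPlane = P'.tangentPlane :=
  congrArg (Quot.lift PointedSubmanifold.tangentPlane fun _ _ h => h.tangentPlane_eq hr) h

theorem PointedSubmanifold.exists_common_chart (hp : P.pt = P'.pt)
    (ht : P.tangentPlane = P'.tangentPlane) :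
    ∃ (u : DividedChart n m E) (f f' : Eu n → Eu m), u.IsGraphAt P.sub.carrier P.pt f ∧
      u.IsGraphAt P'.sub.carrier P.pt f' ∧ f (u.coord P.pt).1 = f' (u.coord P.pt).1 ∧
      fderiv ℝ f (u.coord P.pt).1 = fderiv ℝ f' (u.coord P.pt).1 := by
  obtain ⟨u, f, hu⟩ := P.sub.exists_isGraphAt P.pt P.pt_mem
  obtain ⟨v, g, hv⟩ := P'.sub.exists_isGraphAt P'.pt P'.pt_mem
  have hpL' : P.pt ∈ P'.sub.carrier := hp ▸ P'.pt_mem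
  rw [tangentPlane_eq hu, tangentPlane_eq hv, ← hp] at ht
  rw [← hp] at hv
  obtain ⟨f', hf'⟩ := hv.exists_isGraphAt hpL' hu.1 fun X hX =>
    u.eq_zero_of_mem_tangentPlane hu.1 (ht ▸ hX)
  exact ⟨u, f, f', hu, hf', (hu.snd_eq P.pt_mem).symm.trans (hf'.snd_eq hpL'),
    u.fderiv_eq_of_tangentPlane_eq hu.1 (ht.trans (hv.tangentPlane_eq hf' hpL'))⟩

theorem SubJet.mk_one_eq (hp : P.pt = P'.pt) (ht : P.tangentPlane = P'.tangentPlane) :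
    SubJet.mk 1 P = SubJet.mk 1 P' := by
  obtain ⟨u, f, f', hf, hf', hval, hderiv⟩ := PointedSubmanifold.exists_common_chart hp ht
  exact Quot.sound ⟨hp, u, f, f', hf, hf', iteratedFDeriv_eq_of_le_one hval hderiv⟩

end Contact

section HorizontalJets

variable {n m : ℕ} {E : Type*} [TopologicalSpace E] [ChartedSpace (Eu (n + m)) E]
  [IsManifold (𝓡 (n + m)) ∞ E] {Γ : TorsionFreeConnection (n + m) E}
  {P P' : PointedSubmanifold n m E}

/-- The tangent plane at `[L]¹_p` of the prolongation of the pointed submanifold `(L, p)` is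
horizontal for `Γ̇`. Unlike in `IsDotHorizontal`, the condition is imposed in every concordant
divided chart. -/
def PointedSubmanifold.IsHorizontal (Γ : TorsionFreeConnection (n + m) E)
    (P : PointedSubmanifold n m E) : Prop :=
  ∀ (u : DividedChart n m E) (f : Eu n → Eu m), u.IsGraphAt P.sub.carrier P.pt f →
    ∀ b a : Eu n, dotVertical Γ u P.pt (fderiv ℝ f (u.coord P.pt).1)
      (horLift (fderiv ℝ f (u.coord P.pt).1) b)
      (fderiv ℝ (fderiv ℝ f) (u.coord P.pt).1 b) a = 0

theorem IsParamAt.isHorizontal_iff {F : Type*} [NormedAddCommGroup F] [NormedSpace ℝ F] {e : E → F}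
    {γ : Eu n → E} {x : Eu n} (hγ : IsParamAt (n + m) P.sub.carrier γ x) (hx : γ x = P.pt)
    (he : IsCoordAt (n + m) e P.pt) : P.IsHorizontal Γ ↔
      ∀ b a, covHessian Γ e γ x b a ∈ range (fderiv ℝ (e ∘ γ) x) := by
  rw [← hx] at he
  unfold PointedSubmanifold.IsHorizontal
  rw [← hx]
  refine ⟨fun h => ?_, fun h u f hu => (hγ.dotVertical_eq_zero_iff Γ hu he).2 h⟩
  obtain ⟨u, f, hu⟩ := P.sub.exists_isGraphAt P.pt P.pt_mem
  rw [← hx] at hu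
  exact (hγ.dotVertical_eq_zero_iff Γ hu he).1 (h u f hu)

theorem DividedChart.IsGraphAt.isHorizontal {u : DividedChart n m E} {f : Eu n → Eu m}
    (hu : u.IsGraphAt P.sub.carrier P.pt f)
    (h : ∀ b a : Eu n, dotVertical Γ u P.pt (fderiv ℝ f (u.coord P.pt).1)
      (horLift (fderiv ℝ f (u.coord P.pt).1) b)
      (fderiv ℝ (fderiv ℝ f) (u.coord P.pt).1 b) a = 0) : P.IsHorizontal Γ := by
  have hγ := hu.isParamAt P.pt_mem
  have hbase := hu.graphParam_eq P.pt_mem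
  have he := u.isCoordAt hu.1
  rw [hγ.isHorizontal_iff hbase he]
  rw [← hbase] at he
  refine (hγ.dotVertical_eq_zero_iff Γ (hbase.symm ▸ hu) he).1 ?_
  rwa [hbase]

theorem HasContact.isHorizontal (h : HasContact 2 P P') (hP : P.IsHorizontal Γ) :
    P'.IsHorizontal Γ := by
  obtain ⟨hp, u, f, f', hf, hf', hjet⟩ := h
  refine DividedChart.IsGraphAt.isHorizontal (hp ▸ hf') ?_
  rw [← hp, ← JetEq.fderiv_eq hjet one_le_two, ← JetEq.fderiv_fderiv_eq hjet le_rfl]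
  exact hP u f hf

theorem SubJet.isHorizontal_iff_of_mk_eq (h : SubJet.mk 2 P = SubJet.mk 2 P') :
    P.IsHorizontal Γ ↔ P'.IsHorizontal Γ :=
  iff_of_eq (congrArg (Quot.lift (PointedSubmanifold.IsHorizontal Γ) fun _ _ h =>
    propext ⟨h.isHorizontal, h.symm.isHorizontal⟩) h)

theorem isDotHorizontal_mk_iff : IsDotHorizontal Γ (SubJet.mk 2 P) ↔ P.IsHorizontal Γ := by
  constructor
  · rintro ⟨L, u, f, hL, hu, h⟩
    exact (SubJet.isHorizontal_iff_of_mk_eq hL).1 (hu.isHorizontal h)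
  · intro h
    obtain ⟨u, f, hu⟩ := P.sub.exists_isGraphAt P.pt P.pt_mem
    exact ⟨P, u, f, rfl, hu, h u f hu⟩

theorem SubJet.eq_of_isDotHorizontal {θ θ' : SubJet n m E 2} (h : IsDotHorizontal Γ θ)
    (h' : IsDotHorizontal Γ θ') (hproj : SubJet.proj one_le_two θ = SubJet.proj one_le_two θ') :
    θ = θ' := by
  induction θ using Quot.ind with | mk P =>
  induction θ' using Quot.ind with | mk P' =>
  have hmk : SubJet.mk 1 P = SubJet.mk 1 P' := hproj
  have hp := SubJet.pt_eq_of_mk_eq hmk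
  obtain ⟨u, f, f', hf, hf', hval, hderiv⟩ :=
    PointedSubmanifold.exists_common_chart hp (SubJet.tangentPlane_eq_of_mk_eq le_rfl hmk)
  refine Quot.sound ⟨hp, u, f, f', hf, hf', JetEq.of_fderiv_fderiv_eq hval hderiv ?_⟩
  ext1 b
  ext1 a
  have hhor := isDotHorizontal_mk_iff.1 h u f hf b a
  have hhor' := isDotHorizontal_mk_iff.1 h' u f' (hp ▸ hf') b a
  rw [← hp, ← hderiv] at hhor'
  simp only [dotVertical, vertProj_add] at hhor hhor'
  simpa [vertProj] using add_right_cancel (hhor.trans hhor'.symm)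

end HorizontalJets

section Straightening

variable {V W : Type*} [NormedAddCommGroup V] [NormedSpace ℝ V] [FiniteDimensional ℝ V]
  [NormedAddCommGroup W] [NormedSpace ℝ W] [FiniteDimensional ℝ W]

theorem exists_isInvertible_coprod_subtypeL {A : V →L[ℝ] W} (hA : Function.Injective A) :
    ∃ q : Submodule ℝ W, (A.coprod q.subtypeL).IsInvertible := by
  obtain ⟨q, hq⟩ := Submodule.exists_isCompl (A : V →ₗ[ℝ] W).range
  let T : (V × q) ≃ₗ[ℝ] W :=
    ((LinearEquiv.ofInjective (A : V →ₗ[ℝ] W) hA).prodCongr (.refl ℝ q)).trans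
      (Submodule.prodEquivOfIsCompl _ q hq)
  exact ⟨q, T.toContinuousLinearEquiv, rfl⟩

theorem exists_straightening {c : V → W} {x : V} (hc : ∀ᶠ y in 𝓝 x, ContDiffAt ℝ ∞ c y)
    (hi : Function.Injective (fderiv ℝ c x)) :
    ∃ (q : Submodule ℝ W) (e : (V × q) ≃L[ℝ] W) (Φ : OpenPartialHomeomorph W W),
      c x ∈ Φ.source ∧ ContDiffOn ℝ ∞ Φ Φ.source ∧ ContDiffOn ℝ ∞ Φ.symm Φ.target ∧
      ∀ᶠ y in 𝓝 x, Φ (c y) = e (y, 0) := by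
  obtain ⟨q, hq⟩ := exists_isInvertible_coprod_subtypeL hi
  have hΨ : ∀ᶠ z in 𝓝 (x, (0 : q)), ContDiffAt ℝ ∞ (fun z : V × q => c z.1 + z.2) z := by
    filter_upwards [(continuous_fst.tendsto (x, (0 : q))).eventually hc] with z hz
    exact (hz.comp z contDiffAt_fst).add (q.subtypeL.contDiff.contDiffAt.comp z contDiffAt_snd)
  have hD : HasFDerivAt (fun z : V × q => c z.1 + z.2) ((fderiv ℝ c x).coprod q.subtypeL)
      (x, 0) := by
    have hcD := (hc.self_of_nhds.differentiableAt (by simp)).hasFDerivAt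
    exact (hcD.comp (x, (0 : q)) hasFDerivAt_fst).add
      (q.subtypeL.hasFDerivAt.comp (x, (0 : q)) hasFDerivAt_snd)
  obtain ⟨Ψ, hx, hΨc, hΨs, hΨt⟩ := exists_smooth_openPartialHomeomorph hΨ (hD.fderiv ▸ hq)
  have hΨ₀ : ∀ y, Ψ (y, 0) = c y := fun y => by simp [hΨc]
  obtain ⟨e, -⟩ := hq
  refine ⟨q, e, Ψ.symm.transHomeomorph e.toHomeomorph, ?_, ?_, ?_, ?_⟩
  · simpa [hΨ₀] using Ψ.map_source hx
  · exact e.contDiff.comp_contDiffOn hΨt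
  · exact hΨs.comp e.symm.contDiff.contDiffOn fun y hy => hy
  · filter_upwards [(Continuous.prodMk_left (0 : q)).tendsto x (Ψ.open_source.mem_nhds hx)]
      with y hy
    simp [← hΨ₀, Ψ.left_inv hy]

end Straightening

section Immersions

variable {k l : ℕ} {M N : Type*} [TopologicalSpace M] [ChartedSpace (Eu k) M]
  [TopologicalSpace N] [ChartedSpace (Eu l) N] {f : M → N} {p : M}

theorem exists_mfderiv_comp_symm_eq {ψ : OpenPartialHomeomorph M (Eu k)}
    (hψ : ψ ∈ IsManifold.maximalAtlas (𝓡 k) ∞ M) (hp : p ∈ ψ.source)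
    (hf : MDifferentiableAt (𝓡 k) (𝓡 l) f p) :
    ∃ T : Eu k ≃L[ℝ] Eu k, ∀ b : Eu k,
      mfderiv 𝓘(ℝ, Eu k) (𝓡 l) (f ∘ ψ.symm) (ψ p) b = mfderiv (𝓡 k) (𝓡 l) f p (T b) := by
  have hd : ψ.MDifferentiable (𝓡 k) (𝓡 k) :=
    ⟨(contMDiffOn_of_mem_maximalAtlas hψ).mdifferentiableOn (by simp),
      (contMDiffOn_symm_of_mem_maximalAtlas hψ).mdifferentiableOn (by simp)⟩
  refine ⟨(hd.mfderiv hp).symm, fun b => ?_⟩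
  have hsymm := hd.mdifferentiableAt_symm (ψ.map_source hp)
  rw [mfderiv_comp_of_eq hf hsymm (ψ.left_inv hp), ψ.left_inv hp]
  rfl

theorem injective_mfderiv_of_isImmersionAt (h : IsImmersionAt (𝓡 k) (𝓡 l) ∞ f p) :
    Function.Injective (mfderiv (𝓡 k) (𝓡 l) f p) := by
  have hψ := IsCoordAt.of_mem_maximalAtlas h.domChart_mem_maximalAtlas h.mem_domChart_source
  have hφ := IsCoordAt.of_mem_maximalAtlas h.codChart_mem_maximalAtlas h.mem_codChart_source
  let ι : Eu k →L[ℝ] Eu l :=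
    (h.equiv : Eu k × h.complement →L[ℝ] Eu l) ∘L ContinuousLinearMap.inl ℝ _ _
  have hι : h.codChart ∘ f =ᶠ[𝓝 p] ι ∘ h.domChart := by
    filter_upwards [h.domChart.open_source.mem_nhds h.mem_domChart_source] with q hq
    have hq' : h.domChart q ∈ (h.domChart.extend (𝓡 k)).target := by
      simpa [OpenPartialHomeomorph.extend_target] using h.domChart.map_source hq
    simpa [ι, h.domChart.left_inv hq] using h.writtenInCharts hq'
  have hD : mvfderiv (𝓡 k) (h.codChart ∘ f) p = ι ∘L mvfderiv (𝓡 k) h.domChart p := by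
    rw [mvfderiv_eq_comp_of_eventuallyEq hψ.mdifferentiableAt ι.differentiableAt hι, ι.fderiv]
  have hinj : Function.Injective (mvfderiv (𝓡 k) (h.codChart ∘ f) p) := by
    rw [hD]
    exact (h.equiv.injective.comp (Prod.mk_left_injective 0)).comp hψ.isInvertible.injective
  unfold mvfderiv at hinj
  rw [mfderiv_comp p hφ.mdifferentiableAt (h.contMDiffAt.mdifferentiableAt (by simp))] at hinj
  exact .of_comp hinj

theorem injective_fderiv_comp_symm {ψ : OpenPartialHomeomorph M (Eu k)}
    (hψ : ψ ∈ IsManifold.maximalAtlas (𝓡 k) ∞ M) (hp : p ∈ ψ.source)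
    (hf : MDifferentiableAt (𝓡 k) (𝓡 l) f p)
    (hi : Function.Injective (mfderiv (𝓡 k) (𝓡 l) f p)) {F : Type*} [NormedAddCommGroup F]
    [NormedSpace ℝ F] {e : N → F} (he : IsCoordAt l e (f p)) :
    Function.Injective (fderiv ℝ (e ∘ f ∘ ψ.symm) (ψ p)) := by
  obtain ⟨T, hT⟩ := exists_mfderiv_comp_symm_eq hψ hp hf
  have hsymm := (contMDiffAt_symm_of_mem_maximalAtlas hψ (ψ.map_source hp)).mdifferentiableAt
    (by simp : (∞ : WithTop ℕ∞) ≠ 0)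
  have hγ : MDifferentiableAt 𝓘(ℝ, Eu k) (𝓡 l) (f ∘ ψ.symm) (ψ p) :=
    MDifferentiableAt.comp_of_eq _ hf hsymm (ψ.left_inv hp)
  have hbase : f p = (f ∘ ψ.symm) (ψ p) := by simp [ψ.left_inv hp]
  rw [hbase] at he
  intro b b' h
  rw [fderiv_coord_comp he.mdifferentiableAt hγ, fderiv_coord_comp he.mdifferentiableAt hγ] at h
  have h' := he.isInvertible.injective h
  rw [hT, hT] at h'
  exact T.injective (hi h')

variable [IsManifold (𝓡 l) ∞ N]

theorem trans_mem_maximalAtlas {φ : OpenPartialHomeomorph N (Eu l)}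
    (hφ : φ ∈ IsManifold.maximalAtlas (𝓡 l) ∞ N) {Φ : OpenPartialHomeomorph (Eu l) (Eu l)}
    (hΦ : ContDiffOn ℝ ∞ Φ Φ.source) (hΦ' : ContDiffOn ℝ ∞ Φ.symm Φ.target) :
    φ.trans Φ ∈ IsManifold.maximalAtlas (𝓡 l) ∞ N := by
  refine (φ.trans Φ).mem_maximalAtlas_of_contMDiffOn ?_ ?_
  · rw [φ.trans_source]
    exact hΦ.contMDiffOn.comp ((contMDiffOn_of_mem_maximalAtlas hφ).mono inter_subset_left)
      inter_subset_right
  · rw [φ.trans_target]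
    exact (contMDiffOn_symm_of_mem_maximalAtlas hφ).comp
      (hΦ'.contMDiffOn.mono inter_subset_left) inter_subset_right

variable [IsManifold (𝓡 k) ∞ M]

theorem isImmersionAt_of_injective_mfderiv
    (hf : ∀ᶠ q in 𝓝 p, ContMDiffAt (𝓡 k) (𝓡 l) ∞ f q)
    (hi : Function.Injective (mfderiv (𝓡 k) (𝓡 l) f p)) :
    IsImmersionAt (𝓡 k) (𝓡 l) ∞ f p := by
  set ψ := chartAt (Eu k) p
  set φ := chartAt (Eu l) (f p)
  have hψ : ψ ∈ IsManifold.maximalAtlas (𝓡 k) ∞ M := IsManifold.chart_mem_maximalAtlas p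
  have hφ : φ ∈ IsManifold.maximalAtlas (𝓡 l) ∞ N := IsManifold.chart_mem_maximalAtlas (f p)
  have hp : p ∈ ψ.source := mem_chart_source _ p
  have hfp : f p ∈ φ.source := mem_chart_source _ (f p)
  have hfc := hf.self_of_nhds
  have hc : ∀ᶠ y in 𝓝 (ψ p), ContDiffAt ℝ ∞ (φ ∘ f ∘ ψ.symm) y := by
    have hφf := hfc.continuousAt.eventually
      (IsCoordAt.of_mem_maximalAtlas hφ hfp).eventually_contMDiffAt
    filter_upwards [(ψ.tendsto_symm hp).eventually (hf.and hφf),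
      ψ.open_target.mem_nhds (ψ.map_source hp)] with y hy hyψ
    exact (hy.2.comp y (hy.1.comp y (contMDiffAt_symm_of_mem_maximalAtlas hψ hyψ))).contDiffAt
  obtain ⟨q, e, Φ, hpΦ, hΦs, hΦt, hΦ⟩ := exists_straightening hc
    (injective_fderiv_comp_symm hψ hp (hfc.mdifferentiableAt (by simp)) hi
      (.of_mem_maximalAtlas hφ hfp))
  obtain ⟨S, hS, hSo, hpS⟩ := eventually_nhds_iff.1 ((ψ.continuousAt hp).eventually hΦ)
  have hS' : ∀ x ∈ (ψ.restr S).source, Φ (φ (f x)) = e (ψ x, 0) := by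
    intro x hx
    rw [ψ.restr_source' S hSo] at hx
    simpa [ψ.left_inv hx.1] using hS x hx.2
  refine (IsImmersionAtOfComplement.mk_of_continuousAt (F := q) hfc.continuousAt e
    (ψ.restr S) (φ.trans Φ) ?_ ?_ (restr_mem_maximalAtlas _ hψ hSo)
    (trans_mem_maximalAtlas hφ hΦs hΦt) fun y hy => ?_).isImmersionAt
  · exact ψ.restr_source' S hSo ▸ ⟨hp, hpS⟩
  · simpa [hfp, ψ.left_inv hp] using hpΦ
  · have hy' : y ∈ (ψ.restr S).target := by simpa [OpenPartialHomeomorph.extend_target] using hy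
    simpa [ψ.right_inv hy'.1] using hS' _ ((ψ.restr S).map_target hy')

end Immersions

section Reparametrization

variable {k : ℕ} {N : Type*} [TopologicalSpace N] [ChartedSpace (Eu k) N]

theorem exists_symm_eventuallyEq_symm_comp [IsManifold (𝓡 k) ∞ N]
    {ψ ψ' : OpenPartialHomeomorph N (Eu k)} (hψ : ψ ∈ IsManifold.maximalAtlas (𝓡 k) ∞ N)
    (hψ' : ψ' ∈ IsManifold.maximalAtlas (𝓡 k) ∞ N) {p : N} (hp : p ∈ ψ.source)
    (hp' : p ∈ ψ'.source) :
    ∃ τ : Eu k → Eu k, ContDiffAt ℝ ∞ τ (ψ' p) ∧ Function.Surjective (fderiv ℝ τ (ψ' p)) ∧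
      τ (ψ' p) = ψ p ∧ ψ'.symm =ᶠ[𝓝 (ψ' p)] ψ.symm ∘ τ := by
  have hc := IsCoordAt.of_mem_maximalAtlas hψ hp
  have hc' := IsCoordAt.of_mem_maximalAtlas hψ' hp'
  obtain ⟨τ, hτ, hτψ⟩ := hc'.exists_transition hc.contMDiffAt
  refine ⟨τ, hτ, ?_, hτψ.self_of_nhds.symm, ?_⟩
  · have hsurj : Function.Surjective (mvfderiv (𝓡 k) ψ p) := hc.isInvertible.surjective
    rw [mvfderiv_eq_comp_of_eventuallyEq hc'.mdifferentiableAt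
      (hτ.differentiableAt (by simp)) hτψ] at hsurj
    exact .of_comp hsurj
  · filter_upwards [(ψ'.tendsto_symm hp').eventually (hτψ.and (ψ.open_source.mem_nhds hp)),
      ψ'.open_target.mem_nhds (ψ'.map_source hp')] with y hy hyψ'
    have hψy : ψ (ψ'.symm y) = τ y := by rw [hy.1, Function.comp_apply, ψ'.right_inv hyψ']
    rw [Function.comp_apply, ← hψy, ψ.left_inv hy.2]

variable [IsManifold (𝓡 k) ∞ N] (Γ : TorsionFreeConnection k N)
  {F V V' : Type*} [NormedAddCommGroup F] [NormedSpace ℝ F] [NormedAddCommGroup V]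
  [NormedSpace ℝ V] [NormedAddCommGroup V'] [NormedSpace ℝ V'] {e : N → F} {γ γ' : V → N} {x : V}

theorem covHessian_congr (h : γ =ᶠ[𝓝 x] γ') : covHessian Γ e γ x = covHessian Γ e γ' x := by
  have heγ : e ∘ γ =ᶠ[𝓝 x] e ∘ γ' := h.fun_comp e
  funext b a
  rw [covHessian, covHessian, heγ.fderiv_eq, heγ.fderiv.fderiv_eq, h.self_of_nhds]

theorem covHessian_comp {β : V' → V} {y : V'} (hβ : ContDiffAt ℝ 2 β y)
    (heγ : ContDiffAt ℝ 2 (e ∘ γ) (β y)) (b a : V') :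
    covHessian Γ e (γ ∘ β) y b a =
      covHessian Γ e γ (β y) (fderiv ℝ β y b) (fderiv ℝ β y a) +
        fderiv ℝ (e ∘ γ) (β y) (fderiv ℝ (fderiv ℝ β) y b a) := by
  have hD : fderiv ℝ (e ∘ γ ∘ β) y = fderiv ℝ (e ∘ γ) (β y) ∘L fderiv ℝ β y :=
    fderiv_comp (g := e ∘ γ) y (heγ.differentiableAt (by simp)) (hβ.differentiableAt (by simp))
  have hD₂ := fderiv_fderiv_comp heγ hβ b a
  simp only [Function.comp_assoc] at hD₂
  simp only [covHessian, hD, hD₂, ContinuousLinearMap.comp_apply, Function.comp_apply]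
  abel

theorem covHessian_comp_mem_range {β : V' → V} {y : V'} (hβ : ContDiffAt ℝ 2 β y)
    (hsurj : Function.Surjective (fderiv ℝ β y)) (heγ : ContDiffAt ℝ 2 (e ∘ γ) (β y))
    (h : ∀ b a, covHessian Γ e γ (β y) b a ∈ range (fderiv ℝ (e ∘ γ) (β y))) (b a : V') :
    covHessian Γ e (γ ∘ β) y b a ∈ range (fderiv ℝ (e ∘ γ ∘ β) y) := by
  have hD : fderiv ℝ (e ∘ γ ∘ β) y = fderiv ℝ (e ∘ γ) (β y) ∘L fderiv ℝ β y :=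
    fderiv_comp (g := e ∘ γ) y (heγ.differentiableAt (by simp)) (hβ.differentiableAt (by simp))
  obtain ⟨v, hv⟩ := h (fderiv ℝ β y b) (fderiv ℝ β y a)
  obtain ⟨w, hw⟩ := hsurj (v + fderiv ℝ (fderiv ℝ β) y b a)
  exact ⟨w, by rw [covHessian_comp Γ hβ heγ, hD, ContinuousLinearMap.comp_apply, hw, map_add, hv]⟩

end Reparametrization

section Sections

variable {n m : ℕ} {M E : Type*} [TopologicalSpace M] [ChartedSpace (Eu n) M]
  [TopologicalSpace E] [ChartedSpace (Eu (n + m)) E] {s s' : PointedSection n m M E}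
  {ψ ψ' : OpenPartialHomeomorph M (Eu n)} {φ φ' : OpenPartialHomeomorph E (Eu (n + m))}

namespace PointedSection

theorem eventually_contMDiffAt (s : PointedSection n m M E) :
    ∀ᶠ x in 𝓝 s.pt, ContMDiffAt (𝓡 n) (𝓡 (n + m)) ∞ s.toFun x := by
  filter_upwards [s.isOpen_domain.mem_nhds s.pt_mem] with x hx
  exact s.contMDiffOn.contMDiffAt (s.isOpen_domain.mem_nhds hx)

theorem contMDiffAt (s : PointedSection n m M E) :
    ContMDiffAt (𝓡 n) (𝓡 (n + m)) ∞ s.toFun s.pt :=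
  s.eventually_contMDiffAt.self_of_nhds

theorem mdifferentiableAt (s : PointedSection n m M E) :
    MDifferentiableAt (𝓡 n) (𝓡 (n + m)) s.toFun s.pt :=
  s.contMDiffAt.mdifferentiableAt (by simp)

/-- The differential at the distinguished point `x` of a local section. The tangent spaces `T_x M`
and `T_{s(x)} E` are definitionally the model spaces, so that differentials of sections with
different points or values can be compared. -/
noncomputable def deriv (s : PointedSection n m M E) : Eu n →L[ℝ] Eu (n + m) :=
  mfderiv (𝓡 n) (𝓡 (n + m)) s.toFun s.pt

namespace IsChartPair

theorem congr (hc : s.IsChartPair ψ φ) (hp : s.pt = s'.pt) (hv : s.val = s'.val) :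
    s'.IsChartPair ψ φ :=
  ⟨hc.dom_mem, hc.cod_mem, hp ▸ hc.pt_mem, hv ▸ hc.val_mem⟩

theorem comp_symm_apply (hc : s.IsChartPair ψ φ) : (s.toFun ∘ ψ.symm) (ψ s.pt) = s.val :=
  congrArg s.toFun (ψ.left_inv hc.pt_mem)

theorem contMDiffAt_comp_symm (hc : s.IsChartPair ψ φ) :
    ContMDiffAt 𝓘(ℝ, Eu n) (𝓡 (n + m)) ∞ (s.toFun ∘ ψ.symm) (ψ s.pt) :=
  ContMDiffAt.comp_of_eq s.contMDiffAt
    (contMDiffAt_symm_of_mem_maximalAtlas hc.dom_mem (ψ.map_source hc.pt_mem))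
    (ψ.left_inv hc.pt_mem)

theorem isCoordAt_cod (hc : s.IsChartPair ψ φ) :
    IsCoordAt (n + m) φ s.val :=
  .of_mem_maximalAtlas hc.cod_mem hc.val_mem

theorem isCoordAt_dom (hc : s.IsChartPair ψ φ) :
    IsCoordAt n ψ s.pt :=
  .of_mem_maximalAtlas hc.dom_mem hc.pt_mem

theorem mvfderiv_deriv (hc : s.IsChartPair ψ φ) (X : Eu n) :
    mvfderiv (𝓡 (n + m)) φ s.val (s.deriv X) =
      fderiv ℝ (s.localRep ψ φ) (ψ s.pt) (mvfderiv (𝓡 n) ψ s.pt X) := by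
  have hφ := hc.isCoordAt_cod
  have hψ := hc.isCoordAt_dom
  have hloc : DifferentiableAt ℝ (s.localRep ψ φ) (ψ s.pt) :=
    (contDiffAt_coord_comp le_rfl (hc.comp_symm_apply.symm ▸ hφ)
      hc.contMDiffAt_comp_symm).differentiableAt (by simp)
  have hcomp : φ ∘ s.toFun =ᶠ[𝓝 s.pt] s.localRep ψ φ ∘ ψ := by
    filter_upwards [ψ.open_source.mem_nhds hc.pt_mem] with x hx
    simp [PointedSection.localRep, ψ.left_inv hx]
  have hD := mvfderiv_eq_comp_of_eventuallyEq hψ.mdifferentiableAt hloc hcomp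
  unfold mvfderiv at hD
  rw [mfderiv_comp s.pt hφ.mdifferentiableAt s.mdifferentiableAt] at hD
  exact DFunLike.congr_fun hD X

end IsChartPair

theorem isParamAt_comp_symm (hψ : ψ ∈ IsManifold.maximalAtlas (𝓡 n) ∞ M) (hx : s.pt ∈ ψ.source)
    (hs : Function.Injective s.deriv) {U : Set M} (hU : U ∈ 𝓝 s.pt) :
    IsParamAt (n + m) (s.toFun '' U) (s.toFun ∘ ψ.symm) (ψ s.pt) where
  contMDiffAt := ContMDiffAt.comp_of_eq s.contMDiffAt
    (contMDiffAt_symm_of_mem_maximalAtlas hψ (ψ.map_source hx)) (ψ.left_inv hx)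
  eventually_mem := by
    filter_upwards [ψ.tendsto_symm hx hU] with y hy
    exact mem_image_of_mem s.toFun hy
  injective := by
    obtain ⟨T, hT⟩ := exists_mfderiv_comp_symm_eq hψ hx s.mdifferentiableAt
    intro b b' h
    exact T.injective (hs ((hT b).symm.trans (h.trans (hT b'))))

theorem range_mfderiv_comp_symm (hψ : ψ ∈ IsManifold.maximalAtlas (𝓡 n) ∞ M)
    (hx : s.pt ∈ ψ.source) :
    range (mfderiv 𝓘(ℝ, Eu n) (𝓡 (n + m)) (s.toFun ∘ ψ.symm) (ψ s.pt)) = range s.deriv := by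
  obtain ⟨T, hT⟩ := exists_mfderiv_comp_symm_eq hψ hx s.mdifferentiableAt
  exact (congrArg range (funext hT)).trans (T.surjective.range_comp s.deriv)

theorem IsImmersion.injective_deriv (hs : s.IsImmersion) : Function.Injective s.deriv :=
  injective_mfderiv_of_isImmersionAt (hs s.pt s.pt_mem)

variable [IsManifold (𝓡 (n + m)) ∞ E]

theorem tangentPlane_eq_range_deriv [IsManifold (𝓡 n) ∞ M] (hs : Function.Injective s.deriv)
    {U : Set M} (hU : U ∈ 𝓝 s.pt) {P : PointedSubmanifold n m E}
    (hP : P.sub.carrier = s.toFun '' U) (hpt : P.pt = s.val) : P.tangentPlane = range s.deriv := by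
  have hψ : chartAt (Eu n) s.pt ∈ IsManifold.maximalAtlas (𝓡 n) ∞ M :=
    IsManifold.chart_mem_maximalAtlas _
  have hx := mem_chart_source (Eu n) s.pt
  have hγ := isParamAt_comp_symm hψ hx hs hU
  have hbase : (s.toFun ∘ (chartAt (Eu n) s.pt).symm) (chartAt (Eu n) s.pt s.pt) = P.pt := by
    rw [hpt, Function.comp_apply, (chartAt (Eu n) s.pt).left_inv hx, PointedSection.val]
  obtain ⟨u, f, hu⟩ := P.sub.exists_isGraphAt P.pt P.pt_mem
  rw [PointedSubmanifold.tangentPlane_eq hu, ← range_mfderiv_comp_symm hψ hx, ← hbase]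
  rw [hP, ← hbase] at hu
  exact (hγ.range_mfderiv_eq_tangentPlane hu).symm

/-- The second covariant derivative at the distinguished point of the section, in charts, is
tangential: its values lie in the range of the differential. -/
def HasTangentialHessian (Γ : TorsionFreeConnection (n + m) E) (s : PointedSection n m M E) :
    Prop :=
  ∀ (ψ : OpenPartialHomeomorph M (Eu n)) (φ : OpenPartialHomeomorph E (Eu (n + m))),
    s.IsChartPair ψ φ → ∀ b a : Eu n, covHessian Γ φ (s.toFun ∘ ψ.symm) (ψ s.pt) b a ∈
      range (fderiv ℝ (s.localRep ψ φ) (ψ s.pt))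

variable {Γ : TorsionFreeConnection (n + m) E}

theorem IsChartPair.covHessian_eq (hc : s.IsChartPair ψ φ) (b a : Eu n) :
    covHessian Γ φ (s.toFun ∘ ψ.symm) (ψ s.pt) b a =
      fderiv ℝ (fderiv ℝ (s.localRep ψ φ)) (ψ s.pt) b a +
        christoffel Γ φ s.val (fderiv ℝ (s.localRep ψ φ) (ψ s.pt) b)
          (fderiv ℝ (s.localRep ψ φ) (ψ s.pt) a) := by
  rw [covHessian, hc.comp_symm_apply]
  rfl

variable [IsManifold (𝓡 n) ∞ M]

theorem exists_isChartPair (s : PointedSection n m M E) :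
    ∃ (ψ : OpenPartialHomeomorph M (Eu n)) (φ : OpenPartialHomeomorph E (Eu (n + m))),
      s.IsChartPair ψ φ :=
  ⟨chartAt _ s.pt, chartAt _ s.val, IsManifold.chart_mem_maximalAtlas _,
    IsManifold.chart_mem_maximalAtlas _, mem_chart_source _ _, mem_chart_source _ _⟩

theorem IsChartPair.hasTangentialHessian (hc : s.IsChartPair ψ φ)
    (h : ∀ b a, covHessian Γ φ (s.toFun ∘ ψ.symm) (ψ s.pt) b a ∈
      range (fderiv ℝ (s.localRep ψ φ) (ψ s.pt))) : s.HasTangentialHessian Γ := by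
  intro ψ' φ' hc' b a
  obtain ⟨τ, hτ, hsurj, hτx, hsymm⟩ :=
    exists_symm_eventuallyEq_symm_comp hc.dom_mem hc'.dom_mem hc.pt_mem hc'.pt_mem
  have hγ : s.toFun ∘ ψ'.symm =ᶠ[𝓝 (ψ' s.pt)] (s.toFun ∘ ψ.symm) ∘ τ := hsymm.fun_comp s.toFun
  have hloc : s.localRep ψ' φ' =ᶠ[𝓝 (ψ' s.pt)] φ' ∘ (s.toFun ∘ ψ.symm) ∘ τ := hγ.fun_comp φ'
  have hφ : IsCoordAt (n + m) φ ((s.toFun ∘ ψ.symm) (ψ s.pt)) :=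
    hc.comp_symm_apply.symm ▸ hc.isCoordAt_cod
  have hφ' : IsCoordAt (n + m) φ' ((s.toFun ∘ ψ.symm) (ψ s.pt)) :=
    hc.comp_symm_apply.symm ▸ hc'.isCoordAt_cod
  have hs := hc.contMDiffAt_comp_symm.of_le two_le_infty
  rw [covHessian_congr Γ hγ, hloc.fderiv_eq]
  refine covHessian_comp_mem_range Γ (hτ.of_le two_le_infty) hsurj ?_ ?_ b a
  · rw [hτx]
    exact contDiffAt_coord_comp two_le_infty hφ' hs
  · rw [hτx]
    exact fun b a => covHessian_mem_range_of_mem_range Γ hφ hφ' hs (h b a)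

theorem HasTangentialHessian.isHorizontal (h : s.HasTangentialHessian Γ)
    (hs : Function.Injective s.deriv) {U : Set M} (hU : U ∈ 𝓝 s.pt) {P : PointedSubmanifold n m E}
    (hP : P.sub.carrier = s.toFun '' U) (hpt : P.pt = s.val) : P.IsHorizontal Γ := by
  obtain ⟨ψ, φ, hc⟩ := s.exists_isChartPair
  have hγ := isParamAt_comp_symm hc.dom_mem hc.pt_mem hs hU
  rw [← hP] at hγ
  exact (hγ.isHorizontal_iff (hc.comp_symm_apply.trans hpt.symm)
    (hpt ▸ hc.isCoordAt_cod)).2 (h ψ φ hc)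

end PointedSection

section SameJet

variable {r : ℕ}

theorem HasSameJet.symm (h : HasSameJet r s s') : HasSameJet r s' s := by
  obtain ⟨hp, hv, ψ, φ, hc, hjet⟩ := h
  exact ⟨hp.symm, hv.symm, ψ, φ, hc.congr hp hv, fun k hk => hp ▸ (hjet k hk).symm⟩

theorem SecJet.val_eq_of_mk_eq (h : SecJet.mk r s = SecJet.mk r s') : s.val = s'.val :=
  congrArg (Quot.lift PointedSection.val fun _ _ h => h.2.1) h

theorem HasSameJet.deriv_eq (hr : 1 ≤ r) (h : HasSameJet r s s') : s.deriv = s'.deriv := by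
  obtain ⟨hp, hv, ψ, φ, hc, hjet⟩ := h
  ext1 X
  refine hc.isCoordAt_cod.isInvertible.injective ((hc.mvfderiv_deriv X).trans ?_)
  rw [JetEq.fderiv_eq hjet hr, hv, hp]
  exact ((hc.congr hp hv).mvfderiv_deriv X).symm

theorem SecJet.deriv_eq_of_mk_eq (hr : 1 ≤ r) (h : SecJet.mk r s = SecJet.mk r s') :
    s.deriv = s'.deriv :=
  congrArg (Quot.lift PointedSection.deriv fun _ _ h => h.deriv_eq hr) h

variable [IsManifold (𝓡 n) ∞ M] [IsManifold (𝓡 (n + m)) ∞ E]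
  {Γ : TorsionFreeConnection (n + m) E} {Θ : TorsionFreeConnection n M}

theorem HasSameJet.hasTangentialHessian (h : HasSameJet 2 s s') (hs : s.HasTangentialHessian Γ) :
    s'.HasTangentialHessian Γ := by
  obtain ⟨hp, hv, ψ, φ, hc, hjet⟩ := h
  have hc' := hc.congr hp hv
  refine hc'.hasTangentialHessian fun b a => ?_
  rw [hc'.covHessian_eq, ← hp, ← hv, ← JetEq.fderiv_eq hjet one_le_two,
    ← JetEq.fderiv_fderiv_eq hjet le_rfl, ← hc.covHessian_eq]
  exact hs ψ φ hc b a

namespace SecJet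

theorem hasTangentialHessian_iff_of_mk_eq (h : mk 2 s = mk 2 s') :
    s.HasTangentialHessian Γ ↔ s'.HasTangentialHessian Γ :=
  iff_of_eq (congrArg (Quot.lift (PointedSection.HasTangentialHessian Γ) fun _ _ h =>
    propext ⟨h.hasTangentialHessian, h.symm.hasTangentialHessian⟩) h)

theorem mk_mem_immJet (hs : Function.Injective s.deriv) : mk r s ∈ ImmJet n m M E r := by
  let s' : PointedSection n m M E :=
    { domain := s.domain ∩ {x | IsImmersionAt (𝓡 n) (𝓡 (n + m)) ∞ s.toFun x}
      isOpen_domain := s.isOpen_domain.inter .isImmersionAt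
      toFun := s.toFun
      contMDiffOn := s.contMDiffOn.mono inter_subset_left
      pt := s.pt
      pt_mem := ⟨s.pt_mem, isImmersionAt_of_injective_mfderiv s.eventually_contMDiffAt hs⟩ }
  obtain ⟨ψ, φ, hc⟩ := s.exists_isChartPair
  exact ⟨s', fun x hx => hx.2, Quot.sound ⟨rfl, rfl, ψ, φ, hc.congr rfl rfl, fun _ _ => rfl⟩⟩

theorem mem_immJet_of_proj (hr : 1 ≤ r) {θ : SecJet n m M E r}
    (h : proj hr θ ∈ ImmJet n m M E 1) : θ ∈ ImmJet n m M E r := by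
  induction θ using Quot.ind with | mk s =>
  obtain ⟨s', hs', heq⟩ := h
  exact mk_mem_immJet (deriv_eq_of_mk_eq (r := 1) le_rfl heq ▸ hs'.injective_deriv)

end SecJet

theorem IsDotHorizontalSec.hasTangentialHessian (h : IsDotHorizontalSec Γ Θ (SecJet.mk 2 s)) :
    s.HasTangentialHessian Γ := by
  obtain ⟨s', ψ, φ, hmk, hc, hhor⟩ := h
  refine (SecJet.hasTangentialHessian_iff_of_mk_eq hmk).1 (hc.hasTangentialHessian fun b a => ?_)
  rw [hc.covHessian_eq]
  exact ⟨christoffel Θ ψ s'.pt b a, (sub_eq_zero.1 (hhor b a)).symm⟩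

end SameJet

section Prolongation

theorem prolong_spec {r : ℕ} (θ : ImmJet n m M E r) : IsProlongation r θ.1 (prolong r θ) :=
  (exists_prolongation r θ).choose_spec

variable [IsManifold (𝓡 n) ∞ M] [IsManifold (𝓡 (n + m)) ∞ E]

theorem IsProlongation.proj_eq {r : ℕ} (hr : 1 ≤ r) {θ : SecJet n m M E r} {θ' : SecJet n m M E 1}
    {η : SubJet n m E r} {η' : SubJet n m E 1} (h : IsProlongation r θ η)
    (h' : IsProlongation 1 θ' η') (heq : SecJet.proj hr θ = θ') : SubJet.proj hr η = η' := by
  obtain ⟨s, U, P, hs, rfl, hU, hpU, -, hP, hpt, rfl⟩ := h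
  obtain ⟨s', U', P', hs', rfl, hU', hpU', -, hP', hpt', rfl⟩ := h'
  have hmk : SecJet.mk 1 s = SecJet.mk 1 s' := heq
  refine SubJet.mk_one_eq (P := P)
    (hpt.trans ((SecJet.val_eq_of_mk_eq hmk).trans hpt'.symm)) ?_
  rw [PointedSection.tangentPlane_eq_range_deriv hs.injective_deriv (hU.mem_nhds hpU) hP hpt,
    PointedSection.tangentPlane_eq_range_deriv hs'.injective_deriv (hU'.mem_nhds hpU') hP' hpt',
    SecJet.deriv_eq_of_mk_eq le_rfl hmk]

theorem IsProlongation.isDotHorizontal {Γ : TorsionFreeConnection (n + m) E}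
    {Θ : TorsionFreeConnection n M} {θ : SecJet n m M E 2} {η : SubJet n m E 2}
    (h : IsProlongation 2 θ η) (hθ : IsDotHorizontalSec Γ Θ θ) : IsDotHorizontal Γ η := by
  obtain ⟨s, U, P, hs, rfl, hU, hpU, -, hP, hpt, rfl⟩ := h
  exact isDotHorizontal_mk_iff.2
    (hθ.hasTangentialHessian.isHorizontal hs.injective_deriv (hU.mem_nhds hpU) hP hpt)

end Prolongation

end Sections

end JetSubmfd

theorem mainTheorem9 {n m : ℕ} {M E : Type*}
    [TopologicalSpace M] [ChartedSpace (JetSubmfd.Eu n) M] [IsManifold (𝓡 n) ∞ M]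
    [TopologicalSpace E] [ChartedSpace (JetSubmfd.Eu (n + m)) E] [IsManifold (𝓡 (n + m)) ∞ E]
    (Γ : JetSubmfd.TorsionFreeConnection (n + m) E)
    (Θ : JetSubmfd.TorsionFreeConnection n M) :
    (∀ θ : JetSubmfd.ImmJet n m M E 1,
      ∃ h : JetSubmfd.ddotGammaSec Γ Θ θ.1 ∈ JetSubmfd.ImmJet n m M E 2,
        JetSubmfd.prolong 2 ⟨JetSubmfd.ddotGammaSec Γ Θ θ.1, h⟩ =
          JetSubmfd.ddotGamma Γ (JetSubmfd.prolong 1 θ)) ∧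
    (∀ θ ∈ JetSubmfd.geodesicEquationSec (m := m) Γ Θ,
      JetSubmfd.prolong 2 θ ∈ JetSubmfd.geodesicEquation Γ) := by
  open JetSubmfd in
  refine ⟨fun θ => ?_, fun θ hθ => ?_⟩
  · obtain ⟨hproj, hhor⟩ := ddotGammaSec_spec Γ Θ θ.1
    obtain ⟨hproj', hhor'⟩ := ddotGamma_spec Γ (prolong 1 θ)
    have hmem : ddotGammaSec Γ Θ θ.1 ∈ ImmJet n m M E 2 :=
      SecJet.mem_immJet_of_proj one_le_two (by rw [hproj]; exact θ.2)
    refine ⟨hmem, SubJet.eq_of_isDotHorizontal ((prolong_spec _).isDotHorizontal hhor) hhor' ?_⟩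
    rw [hproj']
    exact (prolong_spec _).proj_eq one_le_two (prolong_spec θ) hproj
  · exact (prolong_spec θ).isDotHorizontal hθ
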